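/- A numerical semigroup $S=\langle d_1,\dots,d_m\rangle$ is given by its minimal generators: positive integers $d_1,\dots,d_m$ with $\gcd(d_1,\dots,d_m)=1$, none of which is a non-negative integer combination of the others. Its Frobenius number $F(S)$ is the largest integer not in $S$. The semigroup $S$ is symmetric if, for every integer $z$, exactly one of $z$ and $F(S)-z$ lies in $S$; it is a complete intersection (CI) if, for a field $k$, the kernel of $k[x_1,\dots,x_m]\to k[t]$, $x_i\mapsto t^{d_i}$, is generated by $m-1$ elements. Lemma 4. Let $a_1,a_2>1$ be integers and let three symmetric (not CI) numerical semigroups $$\mathsf{S}_4=\langle p_1,\dots,p_4\rangle,\qquad \mathsf{W}_5=\langle a_2p_1,\dots,a_2p_4,q_5\rangle,\qquad \mathsf{W}^2_6=\langle a_1q_1,\dots,a_1q_5,d_6\rangle$$ be given, where $q_j=a_2p_j$ for $1\le j\le 4$, such that $$q_5\in\mathsf{S}_4\setminus\{p_1,\dots,p_4\},\qquad d_6\in\mathsf{W}_5\setminus\{q_1,\dots,q_5\},\qquad \gcd(a_1,d_6)=\gcd(a_2,q_5)=1.$$ Then $$F(\mathsf{W}^2_6)\ \ge\ g_{6w^2}-\Bigl(a_1a_2\sum_{j=1}^4p_j+a_1q_5+d_6\Bigr),\qquad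 g_{6w^2}=a_1\Bigl[a_2\Bigl(\sqrt[3]{25}\,\sqrt[3]{p_1p_2p_3p_4}+q_5\Bigr)+d_6\Bigr].$$ -/

import Mathlib

/-- The additive submonoid of `ℕ` generated by the entries of the tuple `d`. -/
def semigroupOf {m : ℕ} (d : Fin m → ℕ) : AddSubmonoid ℕ :=
  AddSubmonoid.closure (Set.range d)

/-- `d` is the minimal system of generators of a numerical semigroup (so that the embedding
dimension of this semigroup is `m`): positive integers with greatest common divisor `1`, none of
which belongs to the monoid generated by the others. -/
structure IsMinimalSystem {m : ℕ} (d : Fin m → ℕ) : Prop where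
  pos : ∀ i, 0 < d i
  gcd_eq_one : Finset.univ.gcd d = 1
  minimal : ∀ i, d i ∉ AddSubmonoid.closure (d '' {j | j ≠ i})

/-- The submonoid `S` of `ℕ`, as a set of integers. -/
def intSet (S : AddSubmonoid ℕ) : Set ℤ := (fun n : ℕ => (n : ℤ)) '' (S : Set ℕ)

/-- `S` is symmetric: with `F` the largest integer outside `S`, for every integer `z` exactly one
of `z` and `F - z` belongs to `S`. -/
def IsSymmetricSemigroup (S : AddSubmonoid ℕ) : Prop :=
  ∃ F : ℤ, IsGreatest {z : ℤ | z ∉ intSet S} F ∧ ∀ z : ℤ, z ∈ intSet S ↔ F - z ∉ intSet S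

/-- The defining ideal of the semigroup ring `k[S]`, `S = ⟨d₁, …, d_m⟩`: the kernel of
`k[x₁, …, x_m] → k[t]`, `x_i ↦ t ^ d_i`. -/
noncomputable def definingIdeal (k : Type*) [Field k] {m : ℕ} (d : Fin m → ℕ) :
    Ideal (MvPolynomial (Fin m) k) :=
  RingHom.ker
    (MvPolynomial.aeval (fun i => (Polynomial.X : Polynomial k) ^ d i) :
      MvPolynomial (Fin m) k →ₐ[k] Polynomial k)

/-- The (one-dimensional) semigroup ring `k[S]`, `S = ⟨d₁, …, d_m⟩`, is a complete intersection:
its defining ideal is generated by `m - 1` elements. -/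
def IsCompleteIntersection (k : Type*) [Field k] {m : ℕ} (d : Fin m → ℕ) : Prop :=
  ∃ f : Fin (m - 1) → MvPolynomial (Fin m) k, Ideal.span (Set.range f) = definingIdeal k d

/-- `d` is the minimal system of generators of a numerical semigroup that is symmetric and not a
complete intersection. -/
structure IsSymmetricNotCI (k : Type*) [Field k] {m : ℕ} (d : Fin m → ℕ) : Prop where
  minimalSystem : IsMinimalSystem d
  symmetric : IsSymmetricSemigroup (semigroupOf d)
  not_ci : ¬ IsCompleteIntersection k d

/-- The generators `a * d₁, …, a * d_m, e` of the semigroup `⟨a S, e⟩`, `S = ⟨d₁, …, d_m⟩`. -/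
def scaleAppend {m : ℕ} (a : ℕ) (d : Fin m → ℕ) (e : ℕ) : Fin (m + 1) → ℕ :=
  Fin.snoc (α := fun _ => ℕ) (fun i => a * d i) e

/-!
The Frobenius number of a semigroup `⟨a S, e⟩` with `gcd (a, e) = 1` and `e ∈ S` is at least
`a F(S) + (a - 1) e`. Two applications reduce the claim to the four-generated semigroup: if
`⟨p₁, …, p₄⟩` is symmetric and not a complete intersection, then `g = F + ∑ p` satisfies
`g ^ 3 ≥ 25 ∏ p` (`CriticalData.bound_of_not_ci`).

For a generator `p_i` let `c_i p_i` be its least positive multiple in the monoid of the other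
three. By symmetry, the elements of the Apéry set of `p_i` are the divisors of its largest element
`F + p_i`. If this element factors uniquely, three binomials generate the defining ideal.
Otherwise two factorizations give an index `j` such that no factorization of `c_j p_j` involves
`p_i`. If the four critical elements `c_j p_j` are distinct, each of them leaves out at most one
other generator, so the left out generators form a permutation without fixed points. A double
transposition contradicts symmetry. For a four-cycle, the factorizations of `g` read off from the
largest Apéry elements give the Bresinsky relations with `g = c₂ p₂ + c₃ p₃ + h₁ p₄` and its
cyclic images. If two critical elements agree, then either symmetry fails or the semigroup is a
gluing of two semigroups with two generators, whose defining ideal again has three generators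
(`CriticalData.exists_gluing`).

In the cyclic case `p₁` divides a maximal minor of the relation matrix, which bounds `p₁ p₂ p₃ p₄`
by a cubic form in the degrees `x_j` of the five relations. These degrees have sum `2 g`, and the
difference between `g ^ 3` and `25` times the form is a multiple of `∑ e_j ^ 2 (3 g / 10 - e_j)`,
where `e_j = x_j - 2 g / 5`. This sum is nonnegative since the degrees of most pairs of relations
add up to at most `g` (`pfaffian_volume_le`).
-/

/-! ### A cubic inequality -/

/-- The inequality of `deviation_sum_nonneg_of_le` in slack variables: one deviation is `3t + y`,
the opposite one is `s`, and the other three are `-(t+y+a)`, `-(t+y+b)`, `-(t+y+c)`. -/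
theorem deviation_sum_nonneg_aux {t y s a b c : ℝ} (hy : 0 ≤ y) (hyt : y ≤ 3 * t)
    (ha : 0 ≤ a) (hb : 0 ≤ b) (hc : 0 ≤ c) (hs : s = 2 * y + (a + b + c)) (hst : s ≤ 3 * t + y) :
    0 ≤ -((3 * t + y) ^ 2 * y) + s ^ 2 * (3 * t - s) + (t + y + a) ^ 2 * (4 * t + y + a)
      + (t + y + b) ^ 2 * (4 * t + y + b) + (t + y + c) ^ 2 * (4 * t + y + c) := by
  have ht : 0 ≤ t := by linarith
  have hsq : ∀ r : ℝ, 0 ≤ r → (t + y) ^ 2 * (4 * t + y) + r * (9 * t ^ 2 + 12 * t * y + 3 * y ^ 2)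
      + 3 * y * r ^ 2 ≤ (t + y + r) ^ 2 * (4 * t + y + r) := by
    intro r hr
    have : (t + y + r) ^ 2 * (4 * t + y + r) - ((t + y) ^ 2 * (4 * t + y)
        + r * (9 * t ^ 2 + 12 * t * y + 3 * y ^ 2) + 3 * y * r ^ 2) = r ^ 2 * (6 * t + r) := by ring
    have h2 : 0 ≤ r ^ 2 * (6 * t + r) := by positivity
    linarith
  have h1 : -(s ^ 2 * y) ≤ s ^ 2 * (3 * t - s) := by
    have : 0 ≤ s ^ 2 * (3 * t + y - s) := mul_nonneg (sq_nonneg s) (by linarith)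
    linarith
  have hR : (a + b + c) ^ 2 ≤ 3 * (a ^ 2 + b ^ 2 + c ^ 2) := by
    nlinarith [sq_nonneg (a - b), sq_nonneg (b - c), sq_nonneg (a - c)]
  have hyR : y * (a + b + c) ^ 2 ≤ y * (3 * (a ^ 2 + b ^ 2 + c ^ 2)) :=
    mul_le_mul_of_nonneg_left hR hy
  set R := a + b + c with hRdef
  have hR0 : 0 ≤ R := by positivity
  have h3 : 0 ≤ y * y * (3 * t - y) := mul_nonneg (by positivity) (by linarith)
  have h4 : 0 ≤ y * R * (3 * t - y) := mul_nonneg (by positivity) (by linarith)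
  have h5 : 0 ≤ t * y * R := by positivity
  have h6 : 0 ≤ t * t * R := by positivity
  have h7 : 0 ≤ t * t * t := by positivity
  have h8 : 0 ≤ t * t * y := by positivity
  have h9 : 0 ≤ t * y * y := by positivity
  have hsum : (t + y) ^ 2 * (4 * t + y) * 3 + R * (9 * t ^ 2 + 12 * t * y + 3 * y ^ 2)
      + y * R ^ 2 ≤ (t + y + a) ^ 2 * (4 * t + y + a)
      + (t + y + b) ^ 2 * (4 * t + y + b) + (t + y + c) ^ 2 * (4 * t + y + c) := by
    have e : R * (9 * t ^ 2 + 12 * t * y + 3 * y ^ 2)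
      = a * (9 * t ^ 2 + 12 * t * y + 3 * y ^ 2) + b * (9 * t ^ 2 + 12 * t * y + 3 * y ^ 2)
        + c * (9 * t ^ 2 + 12 * t * y + 3 * y ^ 2) := by rw [hRdef]; ring
    linarith [hsq a ha, hsq b hb, hsq c hc]
  have h10 : s ^ 2 * y = 4 * (y * y * y) + 4 * (y * y * R) + y * R ^ 2 := by rw [hs]; ring
  nlinarith

/-- The case of `deviation_sum_nonneg` in which the summand of `x` is negative: the deviations
`a`, `b`, `c` are then at most `-t`, and their summands outweigh those of `x` and `v`. -/
theorem deviation_sum_nonneg_of_le {t x v a b c : ℝ} (hsum : x + v + a + b + c = 0)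
    (hx : 3 * t ≤ x) (hx6 : x ≤ 6 * t) (hv : v ≤ x) (ha : x + a ≤ 2 * t) (hb : x + b ≤ 2 * t)
    (hc : x + c ≤ 2 * t) :
    0 ≤ x ^ 2 * (3 * t - x) + v ^ 2 * (3 * t - v) + a ^ 2 * (3 * t - a) + b ^ 2 * (3 * t - b)
      + c ^ 2 * (3 * t - c) := by
  have := deviation_sum_nonneg_aux (t := t) (y := x - 3 * t) (s := v) (a := 2 * t - x - a)
    (b := 2 * t - x - b) (c := 2 * t - x - c) (by linarith) (by linarith) (by linarith)
    (by linarith) (by linarith) (by linarith) (by linarith)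
  have e1 : t + (x - 3 * t) + (2 * t - x - a) = -a := by ring
  have e2 : t + (x - 3 * t) + (2 * t - x - b) = -b := by ring
  have e3 : t + (x - 3 * t) + (2 * t - x - c) = -c := by ring
  have e4 : 4 * t + (x - 3 * t) + (2 * t - x - a) = 3 * t - a := by ring
  have e5 : 4 * t + (x - 3 * t) + (2 * t - x - b) = 3 * t - b := by ring
  have e6 : 4 * t + (x - 3 * t) + (2 * t - x - c) = 3 * t - c := by ring
  rw [e1, e2, e3, e4, e5, e6] at this
  linarith

/-- A cubic inequality for five real numbers of sum zero. A summand `e ^ 2 * (3 * t - e)` is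
negative only for `e > 3 * t`; every pair except `{x, v}` and `{a, b}` is subject to an upper
bound on its sum, so all such `e` belong to one of these two pairs. -/
theorem deviation_sum_nonneg {t x v a b c : ℝ} (hsum : x + v + a + b + c = 0)
    (hx : x ≤ 6 * t) (hv : v ≤ 6 * t) (ha : a ≤ 6 * t) (hb : b ≤ 6 * t)
    (hxa : x + a ≤ 2 * t) (hxb : x + b ≤ 2 * t) (hva : v + a ≤ 2 * t) (hvb : v + b ≤ 2 * t)
    (hxc : x + c ≤ 2 * t) (hvc : v + c ≤ 2 * t) (hac : a + c ≤ 2 * t) (hbc : b + c ≤ 2 * t) :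
    0 ≤ x ^ 2 * (3 * t - x) + v ^ 2 * (3 * t - v) + a ^ 2 * (3 * t - a) + b ^ 2 * (3 * t - b)
      + c ^ 2 * (3 * t - c) := by
  have hc3 : c ≤ 3 * t := by linarith
  by_cases h : x ≤ 3 * t ∧ v ≤ 3 * t ∧ a ≤ 3 * t ∧ b ≤ 3 * t
  · obtain ⟨h1, h2, h3, h4⟩ := h
    have key : ∀ e : ℝ, e ≤ 3 * t → 0 ≤ e ^ 2 * (3 * t - e) := fun e he =>
      mul_nonneg (sq_nonneg e) (by linarith)
    linarith [key x h1, key v h2, key a h3, key b h4, key c hc3]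
  · by_cases hxv : 3 * t < x ∨ 3 * t < v
    · rcases le_total v x with hle | hle
      · have := deviation_sum_nonneg_of_le hsum (by rcases hxv with h | h <;> linarith) hx hle
          hxa hxb hxc
        linarith
      · have := deviation_sum_nonneg_of_le (x := v) (v := x) (a := a) (b := b) (c := c)
          (by linarith) (by rcases hxv with h | h <;> linarith) hv hle hva hvb hvc
        linarith
    · have hab : 3 * t < a ∨ 3 * t < b := by
        by_contra hcon
        push Not at hxv hcon
        exact h ⟨hxv.1, hxv.2, hcon.1, hcon.2⟩
      rcases le_total b a with hle | hle
      · have := deviation_sum_nonneg_of_le (x := a) (v := b) (a := x) (b := v) (c := c)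
          (by linarith) (by rcases hab with h | h <;> linarith) ha hle (by linarith)
          (by linarith) hac
        linarith
      · have := deviation_sum_nonneg_of_le (x := b) (v := a) (a := x) (b := v) (c := c)
          (by linarith) (by rcases hab with h | h <;> linarith) hb hle (by linarith)
          (by linarith) hbc
        linarith

/-- With `x₅ = 2 g - x₁ - x₂ - x₃ - x₄` and deviations `e_j = x_j - 2 g / 5`, the difference of
the two sides is `(25 / 3) * ∑ e_j ^ 2 * (3 g / 10 - e_j)`. Equality holds when all five `x_j` are
`2 g / 5`. -/
theorem pfaffian_volume_le {g x₁ x₂ x₃ x₄ : ℝ}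
    (h12 : x₁ + x₂ ≤ g) (h23 : x₂ + x₃ ≤ g) (h34 : x₃ + x₄ ≤ g) (h41 : x₄ + x₁ ≤ g)
    (h234 : g ≤ x₂ + x₃ + x₄) (h341 : g ≤ x₃ + x₄ + x₁) (h412 : g ≤ x₄ + x₁ + x₂)
    (h123 : g ≤ x₁ + x₂ + x₃) :
    25 * (x₂ * x₃ * (g - x₂ - x₃) + (g - x₄ - x₁) * (x₁ + x₂ + x₃ - g) * (x₂ + x₃ + x₄ - g))
      ≤ g ^ 3 := by
  have := deviation_sum_nonneg (t := g / 10) (x := x₁ - 4 * (g / 10)) (v := x₃ - 4 * (g / 10))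
    (a := x₂ - 4 * (g / 10)) (b := x₄ - 4 * (g / 10))
    (c := 2 * g - x₁ - x₂ - x₃ - x₄ - 4 * (g / 10)) (by ring) (by linarith) (by linarith)
    (by linarith) (by linarith) (by linarith) (by linarith) (by linarith) (by linarith)
    (by linarith) (by linarith) (by linarith) (by linarith)
  nlinarith [this]

/-! ### Critical multiples and the largest Apéry elements -/

/-- `i, j, k, l` are pairwise distinct, that is, an enumeration of the four indices. -/
def Distinct4 (i j k l : Fin 4) : Prop := i ≠ j ∧ i ≠ k ∧ i ≠ l ∧ j ≠ k ∧ j ≠ l ∧ k ≠ l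

theorem Distinct4.univ_eq : ∀ {i j k l : Fin 4}, Distinct4 i j k l →
    (Finset.univ : Finset (Fin 4)) = {i, j, k, l} := by
  unfold Distinct4; decide

theorem Distinct4.sum_eq {M : Type*} [AddCommMonoid M] {i j k l : Fin 4} (h : Distinct4 i j k l)
    (f : Fin 4 → M) : ∑ x, f x = f i + f j + f k + f l := by
  obtain ⟨h1, h2, h3, h4, h5, h6⟩ := id h
  rw [h.univ_eq, Finset.sum_insert (by simp [*]), Finset.sum_insert (by simp [*]),
    Finset.sum_pair h6, add_assoc, add_assoc]

theorem Distinct4.prod_eq {M : Type*} [CommMonoid M] {i j k l : Fin 4} (h : Distinct4 i j k l)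
    (f : Fin 4 → M) : ∏ x, f x = f i * f j * f k * f l := by
  obtain ⟨h1, h2, h3, h4, h5, h6⟩ := id h
  rw [h.univ_eq, Finset.prod_insert (by simp [*]), Finset.prod_insert (by simp [*]),
    Finset.prod_pair h6, mul_assoc, mul_assoc]

theorem Distinct4.rotate {i j k l : Fin 4} (h : Distinct4 i j k l) : Distinct4 j k l i :=
  ⟨h.2.2.2.1, h.2.2.2.2.1, h.1.symm, h.2.2.2.2.2, h.2.1.symm, h.2.2.1.symm⟩

theorem Distinct4.swap {i j k l : Fin 4} (h : Distinct4 i j k l) : Distinct4 j i k l :=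
  ⟨h.1.symm, h.2.2.2.1, h.2.2.2.2.1, h.2.1, h.2.2.1, h.2.2.2.2.2⟩

theorem Distinct4.swapLast {i j k l : Fin 4} (h : Distinct4 i j k l) : Distinct4 i j l k :=
  ⟨h.1, h.2.2.1, h.2.1, h.2.2.2.2.1, h.2.2.2.1, h.2.2.2.2.2.symm⟩

theorem Distinct4.swapMid {i j k l : Fin 4} (h : Distinct4 i j k l) : Distinct4 i k j l :=
  ⟨h.2.1, h.1, h.2.2.1, h.2.2.2.1.symm, h.2.2.2.2.2, h.2.2.2.2.1⟩

theorem exists_distinct4 : ∀ {i j : Fin 4}, i ≠ j → ∃ k l, Distinct4 i j k l := by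
  unfold Distinct4; decide

theorem Distinct4.eq_or : ∀ {i j k l : Fin 4}, Distinct4 i j k l → ∀ m,
    m = i ∨ m = j ∨ m = k ∨ m = l := by
  unfold Distinct4; decide

/-- The numerical data of a symmetric semigroup `S` with positive generators `p 0, …, p 3`, viewed
inside `ℤ`: `F` is its Frobenius number, and `c i` is the least positive integer such that
`c i * p i` is a nonnegative combination of the other generators. A statement
`c j * p j - p i ∈ S` says that some factorization of the critical element `c j * p j` involves
`p i`; for `i ≠ j` its failure is phrased below as `c j * p j` *missing* `p i`. -/
structure CriticalData (p c : Fin 4 → ℤ) (S : AddSubmonoid ℤ) (F : ℤ) : Prop where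
  pos : ∀ i, 0 < p i
  mem_iff : ∀ z, z ∈ S ↔ ∃ a : Fin 4 → ℤ, (∀ i, 0 ≤ a i) ∧ z = ∑ i, a i * p i
  symm : ∀ z, z ∈ S ↔ F - z ∉ S
  c_pos : ∀ i, 0 < c i
  c_rep : ∀ i, ∃ a : Fin 4 → ℤ, (∀ j, 0 ≤ a j) ∧ a i = 0 ∧ c i * p i = ∑ j, a j * p j
  c_le : ∀ i t, 0 < t → ∀ a : Fin 4 → ℤ, (∀ j, 0 ≤ a j) → a i = 0 →
    t * p i = ∑ j, a j * p j → c i ≤ t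

namespace CriticalData

variable {p c : Fin 4 → ℤ} {S : AddSubmonoid ℤ} {F : ℤ} {i j k l : Fin 4}

theorem rep (h : CriticalData p c S F) (hd : Distinct4 i j k l) {z : ℤ} (hz : z ∈ S) :
    ∃ x y u v : ℤ, 0 ≤ x ∧ 0 ≤ y ∧ 0 ≤ u ∧ 0 ≤ v ∧
      z = x * p i + y * p j + u * p k + v * p l := by
  obtain ⟨a, ha, e⟩ := (h.mem_iff z).1 hz
  rw [hd.sum_eq] at e
  exact ⟨_, _, _, _, ha i, ha j, ha k, ha l, e⟩

theorem mul_mem (h : CriticalData p c S F) (i : Fin 4) {x : ℤ} (hx : 0 ≤ x) : x * p i ∈ S := by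
  classical
  refine (h.mem_iff _).2 ⟨fun m => if m = i then x else 0, ?_, ?_⟩
  · intro m; dsimp only; split_ifs <;> simp [hx]
  · simp

theorem mem (h : CriticalData p c S F) (i j k l : Fin 4) {x y u v : ℤ} (hx : 0 ≤ x)
    (hy : 0 ≤ y) (hu : 0 ≤ u) (hv : 0 ≤ v) : x * p i + y * p j + u * p k + v * p l ∈ S :=
  S.add_mem (S.add_mem (S.add_mem (h.mul_mem i hx) (h.mul_mem j hy)) (h.mul_mem k hu))
    (h.mul_mem l hv)

theorem crit_rep (h : CriticalData p c S F) (hd : Distinct4 i j k l) :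
    ∃ y u v : ℤ, 0 ≤ y ∧ 0 ≤ u ∧ 0 ≤ v ∧ c i * p i = y * p j + u * p k + v * p l := by
  obtain ⟨a, ha, h0, e⟩ := h.c_rep i
  rw [hd.sum_eq, h0, zero_mul, zero_add] at e
  exact ⟨_, _, _, ha j, ha k, ha l, e⟩

theorem crit_le (h : CriticalData p c S F) (hd : Distinct4 i j k l) {t y u v : ℤ} (ht : 0 < t)
    (hy : 0 ≤ y) (hu : 0 ≤ u) (hv : 0 ≤ v) (e : t * p i = y * p j + u * p k + v * p l) :
    c i ≤ t := by
  classical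
  obtain ⟨h1, h2, h3, h4, h5, h6⟩ := id hd
  refine h.c_le i t ht (fun m => if m = j then y else if m = k then u else if m = l then v else 0)
    ?_ ?_ ?_
  · intro m; split_ifs <;> simp [*]
  · simp [*]
  · rw [hd.sum_eq]; simp [*, h4.symm, h5.symm, h6.symm]

/-- Below the critical multiple there are only trivial relations. -/
theorem eq_zero_of_lt (h : CriticalData p c S F) (hd : Distinct4 i j k l) {t y u v : ℤ}
    (ht : t < c i) (hy : 0 ≤ y) (hu : 0 ≤ u) (hv : 0 ≤ v)
    (e : t * p i = y * p j + u * p k + v * p l) : t = 0 ∧ y = 0 ∧ u = 0 ∧ v = 0 := by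
  have ht0 : t ≤ 0 := by
    by_contra hcon
    have := h.crit_le hd (by omega) hy hu hv e
    omega
  have h1 := h.pos i
  have h2 := h.pos j
  have h3 := h.pos k
  have h4 := h.pos l
  have h5 : t * p i ≤ 0 := by nlinarith
  have h6 : 0 ≤ y * p j := by positivity
  have h7 : 0 ≤ u * p k := by positivity
  have h8 : 0 ≤ v * p l := by positivity
  refine ⟨?_, ?_, ?_, ?_⟩
  · exact (mul_eq_zero.1 (by linarith : t * p i = 0)).resolve_right h1.ne'
  · exact (mul_eq_zero.1 (by linarith : y * p j = 0)).resolve_right h2.ne'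
  · exact (mul_eq_zero.1 (by linarith : u * p k = 0)).resolve_right h3.ne'
  · exact (mul_eq_zero.1 (by linarith : v * p l = 0)).resolve_right h4.ne'

theorem frob_notMem (h : CriticalData p c S F) : F ∉ S := by
  have := (h.symm 0).1 S.zero_mem
  simpa using this

theorem sub_mem_of_notMem (h : CriticalData p c S F) {z : ℤ} (hz : z ∉ S) : F - z ∈ S := by
  by_contra hcon
  exact hz ((h.symm z).2 hcon)

/-- The element `(c j - 1) * p j` lies in the Apéry set of every other generator. -/
theorem pred_notMem (h : CriticalData p c S F) (hij : i ≠ j) : (c j - 1) * p j - p i ∉ S := by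
  intro hmem
  obtain ⟨k, l, hd⟩ := exists_distinct4 hij
  obtain ⟨x, y, u, v, hx, hy, hu, hv, e⟩ := h.rep hd hmem
  have := (h.eq_zero_of_lt (hd.swap) (t := c j - 1 - y) (y := x + 1) (u := u) (v := v)
    (by omega) (by omega) hu hv (by linear_combination e)).2.1
  omega

/-- Factorizations of the largest Apéry element `F + p i` do not involve `p i`. -/
theorem coeff_eq_zero (h : CriticalData p c S F) {x y u v : ℤ} (hx : 0 ≤ x) (hy : 0 ≤ y)
    (hu : 0 ≤ u) (hv : 0 ≤ v) (e : F + p i = x * p i + y * p j + u * p k + v * p l) : x = 0 := by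
  by_contra hx0
  refine h.frob_notMem ?_
  have : F = (x - 1) * p i + y * p j + u * p k + v * p l := by linear_combination e
  rw [this]
  exact h.mem i j k l (by omega) hy hu hv

/-- A factorization of the largest Apéry element `F + p i` uses `p j` fewer than `c j` times if
the critical element `c j * p j` does not miss `p i`. -/
theorem lt_of_factorization (h : CriticalData p c S F) {y u v : ℤ} (hu : 0 ≤ u)
    (hv : 0 ≤ v) (e : F + p i = y * p j + u * p k + v * p l) (hm : c j * p j - p i ∈ S) :
    y < c j := by
  by_contra hcon
  refine h.frob_notMem ?_
  have : F = (c j * p j - p i) + ((y - c j) * p j + u * p k + v * p l + 0 * p i) := by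
    linear_combination e
  rw [this]
  exact S.add_mem hm (h.mem j k l i (by omega) hu hv le_rfl)

/-- By symmetry the Apéry element `(c j - 1) * p j` divides the largest one, `F + p i`. -/
theorem exists_factorization_pred (h : CriticalData p c S F) (hd : Distinct4 i j k l)
    (hm : c j * p j - p i ∈ S) :
    ∃ u v : ℤ, 0 ≤ u ∧ 0 ≤ v ∧ F + p i = (c j - 1) * p j + u * p k + v * p l := by
  obtain ⟨x, y, u, v, hx, hy, hu, hv, e⟩ := h.rep hd (h.sub_mem_of_notMem (h.pred_notMem hd.1))
  have hc := h.c_pos j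
  obtain rfl := h.coeff_eq_zero (i := i) (j := j) (k := k) (l := l) (x := x) (y := c j - 1 + y)
    hx (by omega) hu hv (by linear_combination e)
  have := h.lt_of_factorization (i := i) (j := j) (k := k) (l := l) (y := c j - 1 + y) hu hv
    (by linear_combination e) hm
  obtain rfl : y = 0 := by omega
  exact ⟨u, v, hu, hv, by linear_combination e⟩

/-- If the critical elements of `j` and `k` do not miss `p i`, the element `F + ∑ p` has a
factorization over `p j, p k, p l` in which `p j` and `p k` occur with their critical exponents.
Comparing these factorizations for different `i` determines the critical relations. -/
theorem exists_socle (h : CriticalData p c S F) (hd : Distinct4 i j k l)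
    (hj : c j * p j - p i ∈ S) (hk : c k * p k - p i ∈ S) (hl : c l * p l - p j ∈ S) :
    ∃ t : ℤ, 1 ≤ t ∧ t ≤ c l ∧
      F + p i + p j + p k + p l = c j * p j + c k * p k + t * p l := by
  obtain ⟨u, v, hu, hv, e⟩ := h.exists_factorization_pred hd hj
  obtain ⟨u', v', hu', hv', e'⟩ := h.exists_factorization_pred hd.swapMid hk
  have hcj := h.c_pos j
  have hlt := h.lt_of_factorization (i := i) (j := k) (k := j) (l := l) (y := u)
    (u := c j - 1) (by omega) hv (by linear_combination e) hk
  have hlt' := h.lt_of_factorization (i := i) (j := j) (k := k) (l := l) (y := u')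
    (u := c k - 1) (by have := h.c_pos k; omega) hv' (by linear_combination e') hj
  -- a relation between the two factorizations would have a subcritical multiple on one side
  have huk : u = c k - 1 := by
    rcases le_total v v' with hvv | hvv
    · have := h.eq_zero_of_lt (i := j) (j := k) (k := l) (l := i) (t := c j - 1 - u')
        (y := c k - 1 - u) (u := v' - v) (v := 0) hd.rotate (by omega) (by omega) (by omega)
        le_rfl (by linear_combination e' - e)
      omega
    · have := h.eq_zero_of_lt (i := k) (j := j) (k := l) (l := i) (t := c k - 1 - u)
        (y := c j - 1 - u') (u := v - v') (v := 0) hd.swapMid.rotate (by omega) (by omega)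
        (by omega) le_rfl (by linear_combination e - e')
      omega
  subst huk
  refine ⟨v + 1, by omega, ?_, by linear_combination e⟩
  by_contra hcon
  refine h.frob_notMem ?_
  have : F = (c j * p j - p i) + (c l * p l - p j)
      + (0 * p i + 0 * p j + (c k - 1) * p k + (v - c l) * p l) := by
    linear_combination e
  rw [this]
  exact S.add_mem (S.add_mem hj hl) (h.mem i j k l le_rfl le_rfl (by omega) (by omega))

/-- A critical element that misses two other generators is a multiple of the remaining one, and
then the two critical elements agree. -/
theorem crit_eq_of_notMem (h : CriticalData p c S F) (hd : Distinct4 i j k l)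
    (hk : c j * p j - p k ∉ S) (hl : c j * p j - p l ∉ S) : c j * p j = c i * p i := by
  obtain ⟨m, u, v, hm, hu, hv, e⟩ := h.crit_rep hd.swap
  have hu0 : u = 0 := by
    by_contra hne
    refine hk ?_
    have : c j * p j - p k = m * p i + 0 * p j + (u - 1) * p k + v * p l := by
      linear_combination e
    rw [this]
    exact h.mem i j k l hm le_rfl (by omega) hv
  have hv0 : v = 0 := by
    by_contra hne
    refine hl ?_
    have : c j * p j - p l = m * p i + 0 * p j + u * p k + (v - 1) * p l := by
      linear_combination e
    rw [this]
    exact h.mem i j k l hm le_rfl hu (by omega)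
  subst hu0 hv0
  have hpos : 0 < c j * p j := mul_pos (h.c_pos j) (h.pos j)
  have hm0 : 0 < m := by
    rcases hm.lt_or_eq with h0 | h0
    · exact h0
    · subst h0; linarith
  have hle : c i ≤ m := h.crit_le hd (y := c j) (u := 0) (v := 0) hm0 (h.c_pos j).le le_rfl le_rfl
    (by linear_combination -e)
  rcases hle.eq_or_lt with hEq | hlt
  · rw [e, hEq]; ring
  exfalso
  obtain ⟨a, b, d, ha, hb, hd', e2⟩ := h.crit_rep hd
  have e3 : c j * p j = (m - c i) * p i + a * p j + b * p k + d * p l := by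
    linear_combination e + e2
  have ha0 : a = 0 := by
    by_contra hne
    have := h.eq_zero_of_lt hd.swap (t := c j - a) (y := m - c i) (u := b) (v := d) (by omega)
      (by omega) hb hd' (by linear_combination e3)
    omega
  have hb0 : b = 0 := by
    by_contra hne
    refine hk ?_
    have : c j * p j - p k = (m - c i) * p i + a * p j + (b - 1) * p k + d * p l := by
      linear_combination e3
    rw [this]
    exact h.mem i j k l (by omega) ha (by omega) hd'
  have hd0 : d = 0 := by
    by_contra hne
    refine hl ?_
    have : c j * p j - p l = (m - c i) * p i + a * p j + b * p k + (d - 1) * p l := by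
      linear_combination e3
    rw [this]
    exact h.mem i j k l (by omega) ha hb (by omega)
  subst ha0 hb0 hd0
  have := mul_pos (h.c_pos i) (h.pos i)
  linarith

end CriticalData

/-! ### Configurations of critical elements -/

namespace CriticalData

variable {p c : Fin 4 → ℤ} {S : AddSubmonoid ℤ} {F : ℤ} {i j k l : Fin 4}

theorem notMem_of_factorizations (h : CriticalData p c S F) (hd : Distinct4 i j k l)
    {y u v y' u' v' : ℤ} (hy' : 0 ≤ y') (hu : 0 ≤ u) (hv : 0 ≤ v)
    (e : F + p i = y * p j + u * p k + v * p l) (e' : F + p i = y' * p j + u' * p k + v' * p l)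
    (h1 : y' < y) (h2 : u ≤ u') (h3 : v ≤ v') : c j * p j - p i ∉ S := by
  intro hm
  have hlt := h.lt_of_factorization hu hv e hm
  have hle := h.crit_le hd.rotate (t := y - y') (y := u' - u) (u := v' - v) (v := 0) (by omega)
    (by omega) (by omega) le_rfl (by linear_combination e' - e)
  omega

/-- Two factorizations of `F + p i` differ by a relation with a multiple of a single generator on
one side; the critical element of that generator misses `p i`. -/
theorem exists_notMem_of_factorizations (h : CriticalData p c S F) (hd : Distinct4 i j k l)
    {y u v y' u' v' : ℤ} (hy : 0 ≤ y) (hu : 0 ≤ u) (hv : 0 ≤ v) (hy' : 0 ≤ y') (hu' : 0 ≤ u')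
    (hv' : 0 ≤ v') (e : F + p i = y * p j + u * p k + v * p l)
    (e' : F + p i = y' * p j + u' * p k + v' * p l) (hne : ¬ (y = y' ∧ u = u' ∧ v = v')) :
    ∃ m, m ≠ i ∧ c m * p m - p i ∉ S := by
  obtain ⟨hij, hik, hil, -⟩ := id hd
  have hci := h.c_pos i
  -- two factorizations of one element are incomparable
  have n1 : ¬ (y' ≤ y ∧ u' ≤ u ∧ v' ≤ v) := fun ⟨h1, h2, h3⟩ => by
    have := h.eq_zero_of_lt hd (t := 0) (y := y - y') (u := u - u') (v := v - v') hci (by omega)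
      (by omega) (by omega) (by linear_combination e - e')
    omega
  have n2 : ¬ (y ≤ y' ∧ u ≤ u' ∧ v ≤ v') := fun ⟨h1, h2, h3⟩ => by
    have := h.eq_zero_of_lt hd (t := 0) (y := y' - y) (u := u' - u) (v := v' - v) hci (by omega)
      (by omega) (by omega) (by linear_combination e' - e)
    omega
  have hcase : (y' < y ∧ u ≤ u' ∧ v ≤ v') ∨ (y < y' ∧ u' ≤ u ∧ v' ≤ v) ∨
      (u' < u ∧ y ≤ y' ∧ v ≤ v') ∨ (u < u' ∧ y' ≤ y ∧ v' ≤ v) ∨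
      (v' < v ∧ y ≤ y' ∧ u ≤ u') ∨ (v < v' ∧ y' ≤ y ∧ u' ≤ u) := by
    omega
  rcases hcase with ⟨h1, h2, h3⟩ | ⟨h1, h2, h3⟩ | ⟨h1, h2, h3⟩ | ⟨h1, h2, h3⟩ | ⟨h1, h2, h3⟩ |
    ⟨h1, h2, h3⟩
  · exact ⟨j, hij.symm, h.notMem_of_factorizations hd hy' hu hv e e' h1 h2 h3⟩
  · exact ⟨j, hij.symm, h.notMem_of_factorizations hd hy hu' hv' e' e h1 h2 h3⟩
  · exact ⟨k, hik.symm, h.notMem_of_factorizations hd.swapMid (y := u) (y' := u') (u := y)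
      (u' := y') hu' hy hv (by linear_combination e) (by linear_combination e') h1 h2 h3⟩
  · exact ⟨k, hik.symm, h.notMem_of_factorizations hd.swapMid (y := u') (y' := u) (u := y')
      (u' := y) hu hy' hv' (by linear_combination e') (by linear_combination e) h1 h2 h3⟩
  · exact ⟨l, hil.symm, h.notMem_of_factorizations hd.swapLast.swapMid (y := v) (y' := v') (u := y)
      (u' := y') (v := u) (v' := u') hv' hy hu (by linear_combination e) (by linear_combination e')
      h1 h2 h3⟩
  · exact ⟨l, hil.symm, h.notMem_of_factorizations hd.swapLast.swapMid (y := v') (y' := v)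
      (u := y') (u' := y) (v := u') (v' := u) hv hy' hu' (by linear_combination e')
      (by linear_combination e) h1 h2 h3⟩

theorem multiple_mem (h : CriticalData p c S F) (i : Fin 4) : c i * p i - p i ∈ S := by
  have := h.mul_mem i (x := c i - 1) (by have := h.c_pos i; omega)
  rwa [sub_mul, one_mul] at this

theorem false_of_crit_eq_aux (h : CriticalData p c S F) (hd : Distinct4 i j k l)
    (hij : c i * p i = c j * p j) (hik : c k * p k - p i ∉ S) (hil : c l * p l - p i ∈ S)
    (hjl : c l * p l - p j ∉ S) (hjk : c k * p k - p j ∈ S) : False := by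
  have hi := h.multiple_mem i
  have hj := h.multiple_mem j
  obtain ⟨s, hs1, hs, e⟩ := h.exists_socle hd.swapLast (hij ▸ hi) hil hjk
  obtain ⟨t, ht1, ht, e'⟩ := h.exists_socle hd.swap (hij ▸ hj) hjk hil
  have hck := h.c_pos k
  -- the two factorizations of `F + ∑ p` differ in `p k` and `p l` only, below the critical multiples
  have hsk : s = c k := by
    have := h.eq_zero_of_lt hd.rotate.rotate (t := c k - s) (y := c l - t) (u := 0) (v := 0)
      (by omega) (by omega) le_rfl le_rfl (by linear_combination e - e' - hij)
    omega
  subst hsk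
  have hlk : c l * p l - p k ∈ S := by
    by_contra hcon
    have := h.crit_eq_of_notMem hd.swapLast.swapMid hjl hcon
    exact hjl (by rw [this, hij]; exact hj)
  obtain ⟨u, v, hu, hv, e3⟩ := h.exists_factorization_pred (i := k) (j := l) (k := i) (l := j)
    hd.rotate.rotate hlk
  have e4 : c j * p j + c k * p k = (u + 1) * p i + (v + 1) * p j := by
    linear_combination e3 - e
  have hci := h.c_pos i
  have hcj := h.c_pos j
  rcases le_or_gt (c j) (v + 1) with h1 | h1
  · refine hik ?_
    have : c k * p k - p i = u * p i + (v + 1 - c j) * p j + 0 * p k + 0 * p l := by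
      linear_combination e4
    rw [this]
    exact h.mem i j k l hu (by omega) le_rfl le_rfl
  rcases lt_trichotomy (u + 1) (c i) with h2 | h2 | h2
  · have := h.eq_zero_of_lt hd (t := u + 1) (y := c j - v - 1) (u := c k) (v := 0) h2 (by omega)
      hck.le le_rfl (by linear_combination -e4)
    omega
  · have := h.eq_zero_of_lt hd.rotate (t := v + 1) (y := c k) (u := 0) (v := 0) h1 hck.le
      le_rfl le_rfl (by rw [h2] at e4; linear_combination -e4 - hij)
    omega
  · refine hik ?_
    have : c k * p k - p i = (u - c i) * p i + (v + 1) * p j + 0 * p k + 0 * p l := by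
      linear_combination e4 + hij
    rw [this]
    exact h.mem i j k l (by omega) (by omega) le_rfl le_rfl

/-- If two critical elements agree and the other two do not, some generator is missed by no
critical element. -/
theorem false_of_crit_eq (h : CriticalData p c S F) (hd : Distinct4 i j k l)
    (hij : c i * p i = c j * p j) (hkl : c k * p k ≠ c l * p l)
    (hmiss : ∀ i, ∃ m, m ≠ i ∧ c m * p m - p i ∉ S) : False := by
  have hi := h.multiple_mem i
  have hj := h.multiple_mem j
  have key1 : c k * p k - p i ∉ S ∨ c l * p l - p i ∉ S := by
    obtain ⟨m, hm, hn⟩ := hmiss i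
    rcases hd.eq_or m with rfl | rfl | rfl | rfl
    · exact absurd rfl hm
    · exact absurd (hij ▸ hi) hn
    · exact Or.inl hn
    · exact Or.inr hn
  have key2 : c k * p k - p j ∉ S ∨ c l * p l - p j ∉ S := by
    obtain ⟨m, hm, hn⟩ := hmiss j
    rcases hd.eq_or m with rfl | rfl | rfl | rfl
    · exact absurd (hij ▸ hj) hn
    · exact absurd rfl hm
    · exact Or.inl hn
    · exact Or.inr hn
  have hk : ¬ (c k * p k - p i ∉ S ∧ c k * p k - p j ∉ S) := fun ⟨h1, h2⟩ =>
    hkl (h.crit_eq_of_notMem hd.rotate.rotate.swap h1 h2)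
  have hl : ¬ (c l * p l - p i ∉ S ∧ c l * p l - p j ∉ S) := fun ⟨h1, h2⟩ =>
    hkl (h.crit_eq_of_notMem hd.rotate.rotate h1 h2).symm
  rcases key1 with h1 | h1
  · exact h.false_of_crit_eq_aux hd hij h1 (by tauto) (by tauto) (by tauto)
  · exact h.false_of_crit_eq_aux hd.swapLast hij h1 (by tauto) (by tauto) (by tauto)

/-- If the critical elements of `k` and `l` miss neither `p i` nor `p j`, and those of `i` and `j`
do not miss `p k`, then the critical element of `j` does not miss `p i`: two factorizations of
`F + ∑ p` differ only in a multiple of `p j` against a multiple of `p i`. -/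
theorem false_of_double_transposition (h : CriticalData p c S F) (hd : Distinct4 i j k l)
    (hij : c j * p j - p i ∉ S) (hki : c k * p k - p i ∈ S) (hli : c l * p l - p i ∈ S)
    (hkj : c k * p k - p j ∈ S) (hlj : c l * p l - p j ∈ S) (hjk : c j * p j - p k ∈ S)
    (hik : c i * p i - p k ∈ S) : False := by
  obtain ⟨s, hs1, hs, e⟩ := h.exists_socle hd.swapMid.swapLast hki hli hjk
  obtain ⟨t, ht1, ht, e'⟩ := h.exists_socle hd.swap.swapMid.swapLast hkj hlj hik
  have e2 : s * p j = t * p i + 0 * p k + 0 * p l := by linear_combination e' - e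
  have hle := h.crit_le hd.swap (by omega) (by omega) le_rfl le_rfl e2
  obtain rfl : s = c j := by omega
  refine hij ?_
  have : c j * p j - p i = (t - 1) * p i + 0 * p j + 0 * p k + 0 * p l := by
    linear_combination e2
  rw [this]
  exact h.mem i j k l (by omega) le_rfl le_rfl le_rfl

/-- The right-hand side is a maximal minor of the matrix of the three relations. The signed
maximal minors are proportional to the vector `p`, which is primitive, so `p i` divides this
minor. -/
theorem le_minor (h : CriticalData p c S F) (hd : Distinct4 i j k l)
    (hb : ∃ b : Fin 4 → ℤ, ∑ m, b m * p m = 1) {s₁ s₂ s₃ t₁ t₂ t₃ : ℤ}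
    (e₁ : c i * p i = t₁ * p k + s₁ * p l) (e₂ : c j * p j = s₂ * p i + t₂ * p l)
    (e₃ : c k * p k = t₃ * p i + s₃ * p j)
    (hs₁ : 0 < s₁) (hs₃ : 0 ≤ s₃) (ht₁ : 0 ≤ t₁) (ht₂ : 0 ≤ t₂) :
    p i ≤ c j * c k * s₁ + s₃ * t₁ * t₂ := by
  have hj := h.c_pos j
  have hk := h.c_pos k
  refine Int.le_of_dvd (by positivity) ?_
  obtain ⟨b, hb⟩ := hb
  rw [hd.sum_eq] at hb
  have d2 : p i ∣ (c j * c k * s₁ + s₃ * t₁ * t₂) * p j :=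
    ⟨c k * s₁ * s₂ + t₂ * c i * c k - t₂ * t₁ * t₃, by
      linear_combination c k * s₁ * e₂ - t₂ * c k * e₁ - t₂ * t₁ * e₃⟩
  have d3 : p i ∣ (c j * c k * s₁ + s₃ * t₁ * t₂) * p k :=
    ⟨c j * s₁ * t₃ + s₁ * s₃ * s₂ + s₃ * t₂ * c i, by
      linear_combination c j * s₁ * e₃ + s₁ * s₃ * e₂ - s₃ * t₂ * e₁⟩
  have d4 : p i ∣ (c j * c k * s₁ + s₃ * t₁ * t₂) * p l :=
    ⟨c j * c k * c i - c j * t₁ * t₃ - s₃ * t₁ * s₂, by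
      linear_combination -c j * c k * e₁ - c j * t₁ * e₃ - s₃ * t₁ * e₂⟩
  -- a Bézout relation between the generators turns this into divisibility of the minor
  have hD : c j * c k * s₁ + s₃ * t₁ * t₂ = p i * (b i * (c j * c k * s₁ + s₃ * t₁ * t₂))
      + b j * ((c j * c k * s₁ + s₃ * t₁ * t₂) * p j)
      + b k * ((c j * c k * s₁ + s₃ * t₁ * t₂) * p k)
      + b l * ((c j * c k * s₁ + s₃ * t₁ * t₂) * p l) := by
    linear_combination -(c j * c k * s₁ + s₃ * t₁ * t₂) * hb
  rw [hD]
  exact dvd_add (dvd_add (dvd_add (dvd_mul_right _ _) (d2.mul_left _)) (d3.mul_left _))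
    (d4.mul_left _)

/-- The main case: the critical elements miss each other's generators cyclically (that of `j`
misses `p k`, and so on). The four factorizations of `F + ∑ p` from `exists_socle` are the
Bresinsky form of the relations. -/
theorem bound_of_cycle (h : CriticalData p c S F) (hd : Distinct4 i j k l)
    (hb : ∃ b : Fin 4 → ℤ, ∑ m, b m * p m = 1)
    (hji : c j * p j - p i ∈ S) (hki : c k * p k - p i ∈ S)
    (hkj : c k * p k - p j ∈ S) (hlj : c l * p l - p j ∈ S)
    (hlk : c l * p l - p k ∈ S) (hik : c i * p i - p k ∈ S)
    (hil : c i * p i - p l ∈ S) (hjl : c j * p j - p l ∈ S) :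
    25 * ∏ m, p m ≤ (F + ∑ m, p m) ^ 3 := by
  obtain ⟨a, ha1, ha, e1⟩ := h.exists_socle hd hji hki hlj
  obtain ⟨b, hb1, hb', e2⟩ := h.exists_socle hd.rotate hkj hlj hik
  obtain ⟨d, hd1, hd', e3⟩ := h.exists_socle hd.rotate.rotate hlk hik hjl
  obtain ⟨f, hf1, hf, e4⟩ := h.exists_socle hd.rotate.rotate.rotate hil hjl hki
  have hle := h.le_minor hd hb (s₁ := a) (s₂ := b) (s₃ := d) (t₁ := c k - f) (t₂ := c l - a)
    (t₃ := c i - b) (by linear_combination e1 - e4) (by linear_combination e2 - e1)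
    (by linear_combination e3 - e2) (by omega) (by omega) (by omega) (by omega)
  have hpi := h.pos i
  have hpj := h.pos j
  have hpk := h.pos k
  have hpl := h.pos l
  rw [hd.prod_eq, hd.sum_eq, ← add_assoc, ← add_assoc, ← add_assoc]
  set g := F + p i + p j + p k + p l with hg
  have m1 : 0 ≤ a * p l := by positivity
  have m2 : 0 ≤ b * p i := by positivity
  have m3 : 0 ≤ d * p j := by positivity
  have m4 : 0 ≤ f * p k := by positivity
  have l1 : a * p l ≤ c l * p l := mul_le_mul_of_nonneg_right ha hpl.le
  have l2 : b * p i ≤ c i * p i := mul_le_mul_of_nonneg_right hb' hpi.le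
  have l3 : d * p j ≤ c j * p j := mul_le_mul_of_nonneg_right hd' hpj.le
  have l4 : f * p k ≤ c k * p k := mul_le_mul_of_nonneg_right hf hpk.le
  have hvol := pfaffian_volume_le (g := (g : ℝ)) (x₁ := ((c i * p i : ℤ) : ℝ))
    (x₂ := ((c j * p j : ℤ) : ℝ)) (x₃ := ((c k * p k : ℤ) : ℝ)) (x₄ := ((c l * p l : ℤ) : ℝ))
    (by exact_mod_cast (by linarith : c i * p i + c j * p j ≤ g))
    (by exact_mod_cast (by linarith : c j * p j + c k * p k ≤ g))
    (by exact_mod_cast (by linarith : c k * p k + c l * p l ≤ g))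
    (by exact_mod_cast (by linarith : c l * p l + c i * p i ≤ g))
    (by exact_mod_cast (by linarith : g ≤ c j * p j + c k * p k + c l * p l))
    (by exact_mod_cast (by linarith : g ≤ c k * p k + c l * p l + c i * p i))
    (by exact_mod_cast (by linarith : g ≤ c l * p l + c i * p i + c j * p j))
    (by exact_mod_cast (by linarith : g ≤ c i * p i + c j * p j + c k * p k))
  norm_cast at hvol
  refine le_trans ?_ hvol
  have hle' := mul_le_mul_of_nonneg_right hle
    (by positivity : 0 ≤ p j * p k * p l)
  have w1 : g - c j * p j - c k * p k = a * p l := by linear_combination e1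
  have w2 : g - c l * p l - c i * p i = d * p j := by linear_combination e3
  have w3 : c i * p i + c j * p j + c k * p k - g = (c k - f) * p k := by linear_combination -e4
  have w4 : c j * p j + c k * p k + c l * p l - g = (c l - a) * p l := by linear_combination -e1
  rw [w1, w2, w3, w4]
  calc 25 * (p i * p j * p k * p l) = 25 * (p i * (p j * p k * p l)) := by ring
    _ ≤ 25 * ((c j * c k * a + d * (c k - f) * (c l - a)) * (p j * p k * p l)) := by linarith
    _ = _ := by ring

end CriticalData

/-! ### Coinciding critical elements -/

/-- `z` is a nonnegative integer combination of `P` and `Q`. -/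
def comb2 (P Q : ℤ) (z : ℤ) : Prop := ∃ x y : ℤ, 0 ≤ x ∧ 0 ≤ y ∧ z = x * P + y * Q

theorem comb2.nonneg {P Q z : ℤ} (h : comb2 P Q z) (hP : 0 < P) (hQ : 0 < Q) : 0 ≤ z := by
  obtain ⟨x, y, hx, hy, rfl⟩ := h
  positivity

theorem comb2.add {P Q z w : ℤ} (hz : comb2 P Q z) (hw : comb2 P Q w) : comb2 P Q (z + w) := by
  obtain ⟨x, y, hx, hy, rfl⟩ := hz
  obtain ⟨x', y', hx', hy', rfl⟩ := hw
  exact ⟨x + x', y + y', by omega, by omega, by ring⟩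

/-- The half of the symmetry of the semigroup `⟨P, Q⟩`, with Frobenius number `P * Q - P - Q`,
that says that every integer outside has its mirror image inside. -/
theorem comb2_complement {P Q z : ℤ} (hPQ : IsCoprime P Q) (hQ : 0 < Q) (hz : ¬ comb2 P Q z) :
    comb2 P Q (P * Q - P - Q - z) := by
  obtain ⟨a, b, hab⟩ := hPQ
  have h1 := Int.emod_nonneg (z * a) hQ.ne'
  have h2 := Int.emod_lt_of_pos (z * a) hQ
  have h3 := Int.emod_add_mul_ediv (z * a) Q
  set x := z * a % Q
  have e : z = x * P + (z * b + z * a / Q * P) * Q := by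
    linear_combination -z * hab - P * h3
  have hneg : z * b + z * a / Q * P < 0 := by
    by_contra hcon
    exact hz ⟨x, _, h1, by omega, e⟩
  exact ⟨Q - 1 - x, -1 - (z * b + z * a / Q * P), by omega, by omega, by linear_combination -e⟩

namespace CriticalData

variable {p c : Fin 4 → ℤ} {S : AddSubmonoid ℤ} {F : ℤ} {i j k l : Fin 4}

/-- If two critical elements agree, they are the least common multiple of the two generators. -/
theorem exists_gcd_form (h : CriticalData p c S F) (hd : Distinct4 i j k l)
    (hij : c i * p i = c j * p j) : ∃ d P Q : ℤ, 0 < d ∧ 0 < P ∧ 0 < Q ∧ IsCoprime P Q ∧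
      p i = d * P ∧ p j = d * Q ∧ c i = Q ∧ c j = P := by
  have hi := h.pos i
  have hj := h.pos j
  have hci := h.c_pos i
  have hdpos : 0 < ((p i).gcd (p j) : ℤ) := by
    exact_mod_cast Int.gcd_pos_of_ne_zero_left _ hi.ne'
  obtain ⟨P, hP⟩ := Int.gcd_dvd_left (p i) (p j)
  obtain ⟨Q, hQ⟩ := Int.gcd_dvd_right (p i) (p j)
  have hbez := Int.gcd_eq_gcd_ab (p i) (p j)
  set d : ℤ := ((p i).gcd (p j) : ℤ)
  have hP0 : 0 < P := by
    by_contra hcon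
    nlinarith
  have hQ0 : 0 < Q := by
    by_contra hcon
    nlinarith
  have hcop : IsCoprime P Q := by
    refine ⟨Int.gcdA (p i) (p j), Int.gcdB (p i) (p j), ?_⟩
    refine mul_left_cancel₀ hdpos.ne' ?_
    linear_combination -hbez - Int.gcdA (p i) (p j) * hP - Int.gcdB (p i) (p j) * hQ
  have e : c i * P = c j * Q := by
    refine mul_left_cancel₀ hdpos.ne' ?_
    linear_combination hij - c i * hP + c j * hQ
  have hQc : Q ∣ c i := hcop.symm.dvd_of_dvd_mul_right (Dvd.intro_left _ e.symm)
  have h1 : Q ≤ c i := Int.le_of_dvd hci hQc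
  have h2 : c i ≤ Q := h.crit_le hd (t := Q) (y := P) (u := 0) (v := 0) hQ0 hP0.le le_rfl le_rfl
    (by rw [hP, hQ]; ring)
  have h3 : c i = Q := le_antisymm h2 h1
  refine ⟨d, P, Q, hdpos, hP0, hQ0, hcop, hP, hQ, h3, ?_⟩
  refine mul_right_cancel₀ hQ0.ne' ?_
  rw [← e, h3]; ring

/-- If the critical elements agree in pairs and each generator is missed by one of them, `S` is a
gluing of two semigroups with two generators, `S = d ⟨P, Q⟩ + e ⟨R, T⟩` with `e ∈ ⟨P, Q⟩` and
`d ∈ ⟨R, T⟩`. The proof writes the Frobenius number as `F = d F_A + e F_B - κ d e`, with `F_A`,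
`F_B` those of the two pieces, and obtains `κ = -1` from the symmetry of `S` at the element
`m d e - ∑ p`, `m` being the least positive integer with `m e ∈ ⟨P, Q⟩`. -/
theorem exists_gluing (h : CriticalData p c S F) (hd : Distinct4 i j k l)
    (hb : ∃ b : Fin 4 → ℤ, ∑ m, b m * p m = 1)
    (hij : c i * p i = c j * p j) (hkl : c k * p k = c l * p l)
    (hmiss : ∀ i, ∃ m, m ≠ i ∧ c m * p m - p i ∉ S) :
    ∃ d e P Q R T : ℤ, 0 < d ∧ 0 < e ∧ 0 < P ∧ 0 < Q ∧ 0 < R ∧ 0 < T ∧ IsCoprime P Q ∧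
      IsCoprime R T ∧ IsCoprime d e ∧ p i = d * P ∧ p j = d * Q ∧ p k = e * R ∧ p l = e * T ∧
      comb2 P Q e ∧ comb2 R T d := by
  obtain ⟨d, P, Q, hd0, hP, hQ, hPQ, epi, epj, eci, ecj⟩ := h.exists_gcd_form hd hij
  obtain ⟨e, R, T, he0, hR, hT, hRT, epk, epl, eck, ecl⟩ :=
    h.exists_gcd_form hd.rotate.rotate hkl
  have hde : IsCoprime d e := by
    obtain ⟨b, hb⟩ := hb
    rw [hd.sum_eq, epi, epj, epk, epl] at hb
    exact ⟨b i * P + b j * Q, b k * R + b l * T, by linear_combination hb⟩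
  refine ⟨d, e, P, Q, R, T, hd0, he0, hP, hQ, hR, hT, hPQ, hRT, hde, epi, epj, epk, epl, ?_⟩
  -- elements of `S` are the sums `d x + e y` with `x ∈ ⟨P, Q⟩`, `y ∈ ⟨R, T⟩`
  have hmem : ∀ x y : ℤ, comb2 P Q x → comb2 R T y → d * x + e * y ∈ S := by
    rintro _ _ ⟨x, y, hx, hy, rfl⟩ ⟨u, v, hu, hv, rfl⟩
    have := h.mem i j k l hx hy hu hv
    rw [epi, epj, epk, epl] at this
    convert this using 1; ring
  have hrep : ∀ z ∈ S, ∃ x y : ℤ, comb2 P Q x ∧ comb2 R T y ∧ z = d * x + e * y := by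
    intro z hz
    obtain ⟨x, y, u, v, hx, hy, hu, hv, ez⟩ := h.rep hd hz
    exact ⟨_, _, ⟨x, y, hx, hy, rfl⟩, ⟨u, v, hu, hv, rfl⟩, by rw [ez, epi, epj, epk, epl]; ring⟩
  have hi := h.multiple_mem i
  have hj := h.multiple_mem j
  have hk := h.multiple_mem k
  have hl := h.multiple_mem l
  have eβ : c i * p i = d * (P * Q) := by rw [eci, epi]; ring
  have eγ : c k * p k = e * (R * T) := by rw [eck, epk]; ring
  have mki : d * (P * Q) - p k ∉ S := by
    obtain ⟨m, hm, hn⟩ := hmiss k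
    rcases hd.eq_or m with rfl | rfl | rfl | rfl
    · rwa [eβ] at hn
    · rwa [← hij, eβ] at hn
    · exact absurd rfl hm
    · exact absurd (hkl ▸ hk) hn
  have mli : d * (P * Q) - p l ∉ S := by
    obtain ⟨m, hm, hn⟩ := hmiss l
    rcases hd.eq_or m with rfl | rfl | rfl | rfl
    · rwa [eβ] at hn
    · rwa [← hij, eβ] at hn
    · exact absurd (hkl ▸ hl) hn
    · exact absurd rfl hm
  have mik : e * (R * T) - p i ∉ S := by
    obtain ⟨m, hm, hn⟩ := hmiss i
    rcases hd.eq_or m with rfl | rfl | rfl | rfl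
    · exact absurd rfl hm
    · exact absurd (hij ▸ hi) hn
    · rwa [eγ] at hn
    · rwa [← hkl, eγ] at hn
  have mjk : e * (R * T) - p j ∉ S := by
    obtain ⟨m, hm, hn⟩ := hmiss j
    rcases hd.eq_or m with rfl | rfl | rfl | rfl
    · exact absurd (hij ▸ hj) hn
    · exact absurd rfl hm
    · rwa [eγ] at hn
    · rwa [← hkl, eγ] at hn
  -- otherwise the critical element `d P Q` of `p i` and `p j` would involve `p k` or `p l`
  have hA : ∀ n : ℤ, 0 < n → comb2 R T (n * d) → ¬ comb2 P Q (P * Q - n * e) := by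
    rintro n hn ⟨u, v, hu, hv, en⟩ hc
    rcases hu.lt_or_eq with hu0 | rfl
    · refine mki ?_
      have := hmem _ ((u - 1) * R + v * T) hc ⟨u - 1, v, by omega, hv, rfl⟩
      rw [epk]
      convert this using 1
      linear_combination e * en
    · have hv0 : 0 < v := by
        rcases hv.lt_or_eq with hv0 | rfl
        · exact hv0
        · have := mul_pos hn hd0
          simp at en; omega
      refine mli ?_
      have := hmem _ ((v - 1) * T) hc ⟨0, v - 1, le_rfl, by omega, by ring⟩
      rw [epl]
      convert this using 1
      linear_combination e * en
  have hB : ∀ n : ℤ, 0 < n → comb2 P Q (n * e) → ¬ comb2 R T (R * T - n * d) := by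
    rintro n hn ⟨u, v, hu, hv, en⟩ hc
    rcases hu.lt_or_eq with hu0 | rfl
    · refine mik ?_
      have := hmem ((u - 1) * P + v * Q) _ ⟨u - 1, v, by omega, hv, rfl⟩ hc
      rw [epi]
      convert this using 1
      linear_combination d * en
    · have hv0 : 0 < v := by
        rcases hv.lt_or_eq with hv0 | rfl
        · exact hv0
        · have := mul_pos hn he0
          simp at en; omega
      refine mjk ?_
      have := hmem ((v - 1) * Q) _ ⟨0, v - 1, le_rfl, by omega, by ring⟩ hc
      rw [epj]
      convert this using 1
      linear_combination d * en
  -- `F = d F_A + e F_B - κ d e`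
  obtain ⟨κ, hF⟩ : ∃ κ : ℤ, F = d * (P * Q - P - Q) + e * (R * T - R - T) - κ * (d * e) := by
    obtain ⟨u, v, hu, hv, e1⟩ := h.exists_factorization_pred hd (hij ▸ hi)
    obtain ⟨u', v', hu', hv', e2⟩ := h.exists_factorization_pred hd.rotate.rotate (hkl ▸ hk)
    rw [ecj, epi, epj, epk, epl] at e1
    rw [ecl, epi, epj, epk, epl] at e2
    have hdvd : e ∣ P * Q - P - Q - (u' * P + v' * Q) := by
      refine hde.symm.dvd_of_dvd_mul_left ?_
      exact ⟨R * T - R - T - (u * R + v * T), by linear_combination e2 - e1⟩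
    obtain ⟨κ, hκ⟩ := hdvd
    exact ⟨κ, by linear_combination e2 - d * hκ⟩
  -- otherwise the mirror images in the two pieces would sum up to `F`
  have hor : ∀ n : ℤ, comb2 P Q (n * e) ∨ comb2 R T ((κ - n) * d) := by
    intro n
    by_contra hcon
    push Not at hcon
    refine h.frob_notMem ?_
    have := hmem _ _ (comb2_complement hPQ hQ hcon.1) (comb2_complement hRT hT hcon.2)
    convert this using 1
    rw [hF]; ring
  have hPneg : ∀ n : ℤ, comb2 P Q (n * e) → 0 ≤ n := fun n hn =>
    nonneg_of_mul_nonneg_left (hn.nonneg hP hQ) he0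
  have hQneg : ∀ n : ℤ, comb2 R T (n * d) → 0 ≤ n := fun n hn =>
    nonneg_of_mul_nonneg_left (hn.nonneg hR hT) hd0
  -- the least positive `n` with `n e ∈ ⟨P, Q⟩`
  obtain ⟨m, ⟨hm0, hmP⟩, hmin⟩ : ∃ m : ℤ, (0 < m ∧ comb2 P Q (m * e)) ∧
      ∀ n, 0 < n → comb2 P Q (n * e) → m ≤ n := by
    obtain ⟨m, hm, hmin⟩ := Int.exists_least_of_bdd (P := fun n => 0 < n ∧ comb2 P Q (n * e))
      ⟨0, fun z hz => hz.1.le⟩ ⟨P, hP, e, 0, he0.le, le_rfl, by ring⟩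
    exact ⟨m, hm, fun n h1 h2 => hmin n ⟨h1, h2⟩⟩
  have hnot : m * (d * e) - d * P - d * Q - e * R - e * T ∉ S := by
    intro hmem'
    obtain ⟨x, y, hx, hy, exy⟩ := hrep _ hmem'
    have hdvd : d ∣ y + R + T := by
      refine hde.dvd_of_dvd_mul_left ?_
      exact ⟨m * e - P - Q - x, by linear_combination -exy⟩
    obtain ⟨n, hn⟩ := hdvd
    have hn0 : 0 < n := by
      have := hy.nonneg hR hT
      by_contra hcon
      nlinarith
    have hx2 : x + P + Q = (m - n) * e := by
      refine mul_left_cancel₀ hd0.ne' ?_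
      linear_combination -exy - e * hn
    have hc : comb2 P Q ((m - n) * e) := by
      rw [← hx2]
      exact (hx.add ⟨1, 0, by omega, le_rfl, by ring⟩).add ⟨0, 1, le_rfl, by omega, by ring⟩
    have hpos : 0 < m - n := by
      have := hx.nonneg hP hQ
      by_contra hcon
      nlinarith
    have := hmin _ hpos hc
    omega
  obtain ⟨x, y, hx, hy, exy⟩ := hrep _ (h.sub_mem_of_notMem hnot)
  rw [hF] at exy
  obtain ⟨n, hn⟩ : e ∣ P * Q - x := by
    refine hde.symm.dvd_of_dvd_mul_left ?_
    exact ⟨y - R * T + (κ + m) * d, by linear_combination exy⟩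
  have hy2 : y = R * T - (κ + m - n) * d := by
    refine mul_left_cancel₀ he0.ne' ?_
    linear_combination -exy + d * hn
  have hx2 : x = P * Q - n * e := by linear_combination -hn
  have hκm : comb2 P Q ((κ + m) * e) := (hor (κ + m)).resolve_right fun hc => by
    have := hQneg _ hc
    omega
  have hn0 : n = 0 := by
    by_contra hne
    have hnQ : ¬ comb2 R T (n * d) := fun hc =>
      hA n (lt_of_le_of_ne (hQneg n hc) (Ne.symm hne)) hc (hx2 ▸ hx)
    have h1 : comb2 P Q ((κ - n) * e) := (hor (κ - n)).resolve_right fun hc =>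
      hnQ (by convert hc using 1; ring)
    have h2 := hPneg _ h1
    refine hB (κ + m - n) (by omega) ?_ (hy2 ▸ hy)
    convert h1.add hmP using 1; ring
  subst hn0
  have hκ0 : κ + m = 0 := by
    by_contra hne
    exact hB (κ + m) (lt_of_le_of_ne (hPneg _ hκm) (Ne.symm hne)) hκm
      (by rw [hy2] at hy; simpa using hy)
  have h1 : comb2 R T ((κ - -1) * d) := (hor (-1)).resolve_left fun hc => by
    have := hPneg _ hc
    omega
  have hκ : κ = -1 := by have := hQneg _ h1; omega
  subst hκ
  obtain rfl : m = 1 := by omega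
  refine ⟨by simpa using hmP, ?_⟩
  have h2 : comb2 R T ((-1 - -2) * d) := (hor (-2)).resolve_left fun hc => by
    have := hPneg _ hc
    omega
  simpa using h2

end CriticalData

/-! ### Binomial ideals -/

section Monoid

variable {R : Type*} [CommMonoid R]

theorem pow_mul_pow_eq_of_coprime {x y : R} {P Q a b a' b' : ℕ} (hPQ : Nat.Coprime P Q)
    (hQ : 0 < Q) (hxy : x ^ Q = y ^ P) (e : a * P + b * Q = a' * P + b' * Q) :
    x ^ a * y ^ b = x ^ a' * y ^ b' := by
  wlog hle : a' ≤ a generalizing a b a' b'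
  · exact (this e.symm (by omega)).symm
  obtain ⟨s, rfl⟩ := Nat.exists_eq_add_of_le hle
  have e1 : s * P + b * Q = b' * Q := by linarith
  have hdvd : Q ∣ s := by
    refine hPQ.symm.dvd_of_dvd_mul_right ((Nat.dvd_add_left (dvd_mul_left Q b)).1 ?_)
    rw [e1]; exact dvd_mul_left Q b'
  obtain ⟨t, rfl⟩ := hdvd
  have e2 : b' = t * P + b := Nat.eq_of_mul_eq_mul_right hQ (by linarith)
  rw [e2, pow_add, pow_mul, hxy, pow_add, ← pow_mul, mul_comm t P, mul_assoc]

/-- The three binomial relations of a gluing identify all monomials of equal degree. -/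
theorem prod_pow_eq_of_gluing {y₁ y₂ y₃ y₄ : R} {P Q T V d e u v u' v' : ℕ}
    (hPQ : Nat.Coprime P Q) (hTV : Nat.Coprime T V) (hde : Nat.Coprime d e) (hQ : 0 < Q)
    (hV : 0 < V) (he : 0 < e) (eu : e = u * P + v * Q) (ed : d = u' * T + v' * V)
    (h₁ : y₁ ^ Q = y₂ ^ P) (h₂ : y₃ ^ V = y₄ ^ T)
    (h₃ : y₁ ^ u * y₂ ^ v = y₃ ^ u' * y₄ ^ v')
    {a₁ a₂ a₃ a₄ b₁ b₂ b₃ b₄ : ℕ}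
    (hab : a₁ * (d * P) + a₂ * (d * Q) + a₃ * (e * T) + a₄ * (e * V)
      = b₁ * (d * P) + b₂ * (d * Q) + b₃ * (e * T) + b₄ * (e * V)) :
    y₁ ^ a₁ * y₂ ^ a₂ * y₃ ^ a₃ * y₄ ^ a₄ = y₁ ^ b₁ * y₂ ^ b₂ * y₃ ^ b₃ * y₄ ^ b₄ := by
  wlog hle : b₁ * P + b₂ * Q ≤ a₁ * P + a₂ * Q generalizing a₁ a₂ a₃ a₄ b₁ b₂ b₃ b₄
  · exact (this hab.symm (by omega)).symm
  obtain ⟨s, hs⟩ := Nat.exists_eq_add_of_le hle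
  have e1 : d * s + e * (a₃ * T + a₄ * V) = e * (b₃ * T + b₄ * V) := by
    have : d * (a₁ * P + a₂ * Q) = d * (b₁ * P + b₂ * Q) + d * s := by rw [hs, mul_add]
    linarith
  have hdvd : e ∣ s := by
    refine hde.symm.dvd_of_dvd_mul_left
      ((Nat.dvd_add_left (dvd_mul_right e (a₃ * T + a₄ * V))).1 ?_)
    rw [e1]; exact dvd_mul_right e _
  obtain ⟨κ, rfl⟩ := hdvd
  have e2 : b₃ * T + b₄ * V = (a₃ + κ * u') * T + (a₄ + κ * v') * V := by
    refine Nat.eq_of_mul_eq_mul_left he ?_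
    rw [← e1]
    nth_rewrite 1 [ed]
    ring
  have e3 : a₁ * P + a₂ * Q = (b₁ + κ * u) * P + (b₂ + κ * v) * Q := by
    rw [hs]
    nth_rewrite 1 [eu]
    ring
  have f1 := pow_mul_pow_eq_of_coprime hPQ hQ h₁ e3
  have f2 := pow_mul_pow_eq_of_coprime hTV hV h₂ e2
  have f3 : y₁ ^ (κ * u) * y₂ ^ (κ * v) = y₃ ^ (κ * u') * y₄ ^ (κ * v') := by
    rw [mul_comm κ, mul_comm κ, mul_comm κ, mul_comm κ, pow_mul, pow_mul, pow_mul, pow_mul,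
      ← mul_pow, ← mul_pow, h₃]
  calc y₁ ^ a₁ * y₂ ^ a₂ * y₃ ^ a₃ * y₄ ^ a₄
      = (y₁ ^ b₁ * y₂ ^ b₂ * (y₁ ^ (κ * u) * y₂ ^ (κ * v))) * (y₃ ^ a₃ * y₄ ^ a₄) := by
        rw [mul_assoc, f1, pow_add, pow_add, mul_mul_mul_comm (y₁ ^ b₁)]
    _ = y₁ ^ b₁ * y₂ ^ b₂ * (y₃ ^ b₃ * y₄ ^ b₄) := by
        rw [f2, f3, pow_add, pow_add, mul_mul_mul_comm (y₃ ^ a₃), mul_assoc, mul_assoc, mul_assoc,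
          mul_comm (y₃ ^ a₃ * y₄ ^ a₄)]
        simp only [mul_assoc]
    _ = _ := by simp only [mul_assoc]

/-- Three relations that trade the powers `y₂ ^ (a + 1)`, `y₃ ^ (b + 1)`, `y₄ ^ (d + 1)` for
multiples of `y₁` reduce every monomial to one whose last three exponents lie in the box
`[0, a] × [0, b] × [0, d]`; the reduction terminates because the degree carried by `y₂, y₃, y₄`
drops. -/
theorem exists_reduced {n₁ n₂ n₃ n₄ : ℕ} (hn : 0 < n₁) {y₁ y₂ y₃ y₄ : R} {a b d : ℕ}
    (hj : ∃ x y u v : ℕ, (a + 1) * n₂ = (x + 1) * n₁ + y * n₂ + u * n₃ + v * n₄ ∧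
      y₂ ^ (a + 1) = y₁ ^ (x + 1) * y₂ ^ y * y₃ ^ u * y₄ ^ v)
    (hk : ∃ x y u v : ℕ, (b + 1) * n₃ = (x + 1) * n₁ + y * n₂ + u * n₃ + v * n₄ ∧
      y₃ ^ (b + 1) = y₁ ^ (x + 1) * y₂ ^ y * y₃ ^ u * y₄ ^ v)
    (hl : ∃ x y u v : ℕ, (d + 1) * n₄ = (x + 1) * n₁ + y * n₂ + u * n₃ + v * n₄ ∧
      y₄ ^ (d + 1) = y₁ ^ (x + 1) * y₂ ^ y * y₃ ^ u * y₄ ^ v)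
    (N : ℕ) : ∀ α β γ δ : ℕ, β * n₂ + γ * n₃ + δ * n₄ = N →
    ∃ t β' γ' δ' : ℕ, β' ≤ a ∧ γ' ≤ b ∧ δ' ≤ d ∧
      t * n₁ + β' * n₂ + γ' * n₃ + δ' * n₄ = α * n₁ + β * n₂ + γ * n₃ + δ * n₄ ∧
      y₁ ^ t * y₂ ^ β' * y₃ ^ γ' * y₄ ^ δ' = y₁ ^ α * y₂ ^ β * y₃ ^ γ * y₄ ^ δ := by
  obtain ⟨x₁, y₁', u₁, v₁, e₁, f₁⟩ := hj
  obtain ⟨x₂, y₂', u₂, v₂, e₂, f₂⟩ := hk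
  obtain ⟨x₃, y₃', u₃, v₃, e₃, f₃⟩ := hl
  induction N using Nat.strong_induction_on with
  | _ N ih =>
  intro α β γ δ hN
  by_cases h1 : a + 1 ≤ β
  · obtain ⟨β, rfl⟩ := Nat.exists_eq_add_of_le h1
    have hlt : (β + y₁') * n₂ + (γ + u₁) * n₃ + (δ + v₁) * n₄ < N := by nlinarith
    obtain ⟨t, β', γ', δ', ha, hb, hd, e, f⟩ := ih _ hlt (α + x₁ + 1) _ _ _ rfl
    refine ⟨t, β', γ', δ', ha, hb, hd, by rw [e]; linarith, ?_⟩
    rw [f, pow_add y₂ (a + 1), f₁]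
    simp only [pow_add, pow_one]
    ac_rfl
  by_cases h2 : b + 1 ≤ γ
  · obtain ⟨γ, rfl⟩ := Nat.exists_eq_add_of_le h2
    have hlt : (β + y₂') * n₂ + (γ + u₂) * n₃ + (δ + v₂) * n₄ < N := by nlinarith
    obtain ⟨t, β', γ', δ', ha, hb, hd, e, f⟩ := ih _ hlt (α + x₂ + 1) _ _ _ rfl
    refine ⟨t, β', γ', δ', ha, hb, hd, by rw [e]; linarith, ?_⟩
    rw [f, pow_add y₃ (b + 1), f₂]
    simp only [pow_add, pow_one]
    ac_rfl
  by_cases h3 : d + 1 ≤ δ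
  · obtain ⟨δ, rfl⟩ := Nat.exists_eq_add_of_le h3
    have hlt : (β + y₃') * n₂ + (γ + u₃) * n₃ + (δ + v₃) * n₄ < N := by nlinarith
    obtain ⟨t, β', γ', δ', ha, hb, hd, e, f⟩ := ih _ hlt (α + x₃ + 1) _ _ _ rfl
    refine ⟨t, β', γ', δ', ha, hb, hd, by rw [e]; linarith, ?_⟩
    rw [f, pow_add y₄ (d + 1), f₃]
    simp only [pow_add, pow_one]
    ac_rfl
  exact ⟨α, β, γ, δ, by omega, by omega, by omega, rfl, rfl⟩

end Monoid

section Ideal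

variable {k : Type*} [Field k]

theorem aeval_X_pow_monomial {m : ℕ} (d : Fin m → ℕ) (a : Fin m →₀ ℕ) (r : k) :
    MvPolynomial.aeval (fun i => (Polynomial.X : Polynomial k) ^ d i)
      (MvPolynomial.monomial a r) = Polynomial.monomial (∑ i, a i * d i) r := by
  rw [MvPolynomial.aeval_monomial, Finsupp.prod_fintype _ _ (by simp)]
  simp only [← pow_mul, Finset.prod_pow_eq_pow_sum, mul_comm (d _)]
  rw [← Polynomial.C_mul_X_pow_eq_monomial]; rfl

/-- The defining ideal is contained in every ideal that contains the differences of monomials of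
equal degree: modulo such an ideal, `f` is congruent to the image of `f(t ^ d₁, …, t ^ d_m)` under
the linear map that sends `t ^ n` to a chosen monomial of degree `n`. -/
theorem definingIdeal_le {m : ℕ} {d : Fin m → ℕ} {J : Ideal (MvPolynomial (Fin m) k)}
    (hJ : ∀ a b : Fin m →₀ ℕ, ∑ i, a i * d i = ∑ i, b i * d i →
      MvPolynomial.monomial a (1 : k) - MvPolynomial.monomial b 1 ∈ J) :
    definingIdeal k d ≤ J := by
  classical
  let rep : ℕ → (Fin m →₀ ℕ) := fun n =>
    if h : ∃ a : Fin m →₀ ℕ, ∑ i, a i * d i = n then h.choose else 0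
  have hrep : ∀ a : Fin m →₀ ℕ, ∑ i, rep (∑ i, a i * d i) i * d i = ∑ i, a i * d i := by
    intro a
    have h : ∃ b : Fin m →₀ ℕ, ∑ i, b i * d i = ∑ i, a i * d i := ⟨a, rfl⟩
    simp only [rep, dif_pos h]
    exact h.choose_spec
  let Φ : Polynomial k →ₗ[k] MvPolynomial (Fin m) k :=
    Polynomial.lsum fun n => MvPolynomial.monomial (rep n)
  have key : ∀ f : MvPolynomial (Fin m) k,
      f - Φ (MvPolynomial.aeval (fun i => (Polynomial.X : Polynomial k) ^ d i) f) ∈ J := by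
    intro f
    induction f using MvPolynomial.induction_on' with
    | monomial a r =>
      have h1 : Φ (Polynomial.monomial (∑ i, a i * d i) r)
          = MvPolynomial.monomial (rep (∑ i, a i * d i)) r := by
        simp [Φ, Polynomial.lsum_apply, Polynomial.sum_monomial_index]
      rw [aeval_X_pow_monomial, h1]
      have h2 := J.mul_mem_left (MvPolynomial.C r) (hJ a (rep (∑ i, a i * d i)) (hrep a).symm)
      rwa [mul_sub, MvPolynomial.C_mul_monomial, MvPolynomial.C_mul_monomial, mul_one] at h2
    | add f g hf hg =>
      rw [map_add, map_add, add_sub_add_comm]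
      exact J.add_mem hf hg
  intro f hf
  have h0 : MvPolynomial.aeval (fun i => (Polynomial.X : Polynomial k) ^ d i) f = 0 := hf
  have := key f
  rwa [h0, map_zero, sub_zero] at this

theorem isCompleteIntersection_of_quotient {p : Fin 4 → ℕ} {f : Fin 3 → MvPolynomial (Fin 4) k}
    (hf : ∀ r, f r ∈ definingIdeal k p)
    (H : ∀ a b : Fin 4 → ℕ, ∑ i, a i * p i = ∑ i, b i * p i →
      ∏ i, Ideal.Quotient.mk (Ideal.span (Set.range f)) (MvPolynomial.X i) ^ a i
        = ∏ i, Ideal.Quotient.mk (Ideal.span (Set.range f)) (MvPolynomial.X i) ^ b i) :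
    IsCompleteIntersection k p := by
  refine ⟨f, le_antisymm (Ideal.span_le.2 ?_) (definingIdeal_le fun a b hab => ?_)⟩
  · rintro _ ⟨r, rfl⟩
    exact hf r
  · rw [← Ideal.Quotient.eq, MvPolynomial.monomial_eq, MvPolynomial.monomial_eq,
      Finsupp.prod_fintype _ _ (by simp), Finsupp.prod_fintype _ _ (by simp)]
    simpa using H a b hab

end Ideal

/-! ### Complete intersections and the bound for four generators -/

section Criteria

variable {k : Type*} [Field k] {p : Fin 4 → ℕ} {i j l m : Fin 4}

theorem binomial_mem_definingIdeal {a b c d a' b' c' d' : ℕ}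
    (e : a * p i + b * p j + c * p l + d * p m = a' * p i + b' * p j + c' * p l + d' * p m) :
    (MvPolynomial.X i ^ a * MvPolynomial.X j ^ b * MvPolynomial.X l ^ c * MvPolynomial.X m ^ d
      - MvPolynomial.X i ^ a' * MvPolynomial.X j ^ b' * MvPolynomial.X l ^ c'
        * MvPolynomial.X m ^ d' : MvPolynomial (Fin 4) k) ∈ definingIdeal k p := by
  rw [definingIdeal, RingHom.mem_ker]
  simp only [map_sub, map_mul, map_pow, MvPolynomial.aeval_X, ← pow_mul, ← pow_add]
  rw [sub_eq_zero]
  congr 1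
  linarith

/-- Three homogeneous binomials generate the defining ideal if they identify all monomials of
equal degree. The four entries of an exponent vector `a r` belong to the variables `i, j, l, m`,
in this order. -/
theorem isCompleteIntersection_of_binomials (hd : Distinct4 i j l m)
    (a b : Fin 3 → Fin 4 → ℕ)
    (hdeg : ∀ r, a r 0 * p i + a r 1 * p j + a r 2 * p l + a r 3 * p m
      = b r 0 * p i + b r 1 * p j + b r 2 * p l + b r 3 * p m)
    (H : ∀ (J : Ideal (MvPolynomial (Fin 4) k)) (y : Fin 4 → MvPolynomial (Fin 4) k ⧸ J),
      (∀ r, y i ^ a r 0 * y j ^ a r 1 * y l ^ a r 2 * y m ^ a r 3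
        = y i ^ b r 0 * y j ^ b r 1 * y l ^ b r 2 * y m ^ b r 3) →
      ∀ u v : Fin 4 → ℕ, u i * p i + u j * p j + u l * p l + u m * p m
          = v i * p i + v j * p j + v l * p l + v m * p m →
        y i ^ u i * y j ^ u j * y l ^ u l * y m ^ u m
          = y i ^ v i * y j ^ v j * y l ^ v l * y m ^ v m) :
    IsCompleteIntersection k p := by
  refine isCompleteIntersection_of_quotient (f := fun r =>
    MvPolynomial.X i ^ a r 0 * MvPolynomial.X j ^ a r 1 * MvPolynomial.X l ^ a r 2
      * MvPolynomial.X m ^ a r 3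
    - MvPolynomial.X i ^ b r 0 * MvPolynomial.X j ^ b r 1 * MvPolynomial.X l ^ b r 2
      * MvPolynomial.X m ^ b r 3)
    (fun r => binomial_mem_definingIdeal (hdeg r)) fun u v huv => ?_
  rw [hd.sum_eq, hd.sum_eq] at huv
  rw [hd.prod_eq, hd.prod_eq]
  refine H _ (fun n => Ideal.Quotient.mk _ (MvPolynomial.X n)) (fun r => ?_) u v huv
  simp only [← map_pow, ← map_mul]
  exact Ideal.Quotient.eq.2 (Ideal.subset_span ⟨r, rfl⟩)

theorem isCompleteIntersection_of_gluing (hd : Distinct4 i j l m) {P Q T V d e u v u' v' : ℕ}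
    (hPQ : Nat.Coprime P Q) (hTV : Nat.Coprime T V) (hde : Nat.Coprime d e) (hQ : 0 < Q)
    (hV : 0 < V) (he : 0 < e) (eu : e = u * P + v * Q) (ed : d = u' * T + v' * V)
    (hi : p i = d * P) (hj : p j = d * Q) (hl : p l = e * T) (hm : p m = e * V) :
    IsCompleteIntersection k p := by
  refine isCompleteIntersection_of_binomials hd ![![Q, 0, 0, 0], ![0, 0, V, 0], ![u, v, 0, 0]]
    ![![0, P, 0, 0], ![0, 0, 0, T], ![0, 0, u', v']] ?_ ?_
  · intro r
    rw [hi, hj, hl, hm]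
    fin_cases r
    · simp; ring
    · simp; ring
    · have : u * (d * P) + v * (d * Q) = u' * (e * T) + v' * (e * V) := by
        calc u * (d * P) + v * (d * Q) = d * (u * P + v * Q) := by ring
          _ = d * e := by rw [← eu]
          _ = e * (u' * T + v' * V) := by rw [← ed, mul_comm]
          _ = _ := by ring
      simpa using this
  · intro J y hy a b hab
    rw [hi, hj, hl, hm] at hab
    exact prod_pow_eq_of_gluing hPQ hTV hde hQ hV he eu ed (by simpa using hy 0)
      (by simpa using hy 1) (by simpa using hy 2) hab

end Criteria

namespace CriticalData

variable {p : Fin 4 → ℕ} {c : Fin 4 → ℤ} {S : AddSubmonoid ℤ} {F : ℤ} {i j k l : Fin 4}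

/-- If `p j` occurs exactly `a` times in every factorization of `F + p i`, then `(a + 1) * p j` is
outside the Apéry set of `p i`. -/
theorem exists_raise (h : CriticalData (fun n => (p n : ℤ)) c S F) (hd : Distinct4 i j k l)
    {a : ℕ} (huniq : ∀ y u v : ℤ, 0 ≤ y → 0 ≤ u → 0 ≤ v →
      F + p i = y * p j + u * p k + v * p l → y = a) :
    ∃ x y u v : ℕ, (a + 1) * p j = (x + 1) * p i + y * p j + u * p k + v * p l := by
  have hmem : ((a : ℤ) + 1) * p j - p i ∈ S := by
    by_contra hcon
    obtain ⟨x, y, u, v, hx, hy, hu, hv, e⟩ := h.rep hd (h.sub_mem_of_notMem hcon)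
    have e2 : F + p i = x * p i + (a + 1 + y) * p j + u * p k + v * p l := by
      linear_combination e
    obtain rfl := h.coeff_eq_zero (i := i) (j := j) (k := k) (l := l) hx (by omega) hu hv e2
    have := huniq (a + 1 + y) u v (by omega) hu hv (by linear_combination e2)
    omega
  obtain ⟨x, y, u, v, hx, hy, hu, hv, e⟩ := h.rep hd hmem
  lift x to ℕ using hx
  lift y to ℕ using hy
  lift u to ℕ using hu
  lift v to ℕ using hv
  refine ⟨x, y, u, v, ?_⟩
  have : ((a : ℤ) + 1) * p j = (x + 1) * p i + y * p j + u * p k + v * p l := by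
    linear_combination e
  exact_mod_cast this

/-- If the largest Apéry element `F + p i` factors uniquely, the Apéry set of `p i` is a box of
monomials, and the three relations that leave the box generate the defining ideal. -/
theorem isCompleteIntersection_of_unique {K : Type*} [Field K]
    (h : CriticalData (fun n => (p n : ℤ)) c S F) (hd : Distinct4 i j k l)
    (huniq : ∀ y u v y' u' v' : ℤ, 0 ≤ y → 0 ≤ u → 0 ≤ v → 0 ≤ y' → 0 ≤ u' → 0 ≤ v' →
      F + p i = y * p j + u * p k + v * p l → F + p i = y' * p j + u' * p k + v' * p l →
      y = y' ∧ u = u' ∧ v = v') : IsCompleteIntersection K p := by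
  have hpi : 0 < p i := by exact_mod_cast h.pos i
  have hmem : F - -(p i : ℤ) ∈ S := by
    refine h.sub_mem_of_notMem fun hneg => ?_
    obtain ⟨x, y, u, v, hx, hy, hu, hv, e⟩ := h.rep hd hneg
    have : 0 ≤ x * p i + y * p j + u * p k + v * p l := by positivity
    omega
  obtain ⟨x, a, b, d, hx, ha, hb, hd0, e⟩ := h.rep hd hmem
  obtain rfl := h.coeff_eq_zero (i := i) (j := j) (k := k) (l := l) hx ha hb hd0
    (by linear_combination e)
  lift a to ℕ using ha
  lift b to ℕ using hb
  lift d to ℕ using hd0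
  have e0 : F + p i = a * p j + b * p k + d * p l := by linear_combination e
  obtain ⟨x₁, y₁, u₁, v₁, r₁⟩ := h.exists_raise hd (a := a) fun y u v hy hu hv e' =>
    (huniq _ _ _ _ _ _ hy hu hv (by omega) (by omega) (by omega) e' e0).1
  obtain ⟨x₂, u₂, y₂, v₂, r₂⟩ := h.exists_raise hd.swapMid (a := b) fun u y v hu hy hv e' =>
    (huniq y u v _ _ _ hy hu hv (by omega) (by omega) (by omega) (by linear_combination e') e0).2.1
  obtain ⟨x₃, v₃, y₃, u₃, r₃⟩ := h.exists_raise hd.swapLast.swapMid (a := d)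
    fun v y u hv hy hu e' =>
    (huniq y u v _ _ _ hy hu hv (by omega) (by omega) (by omega) (by linear_combination e') e0).2.2
  refine isCompleteIntersection_of_binomials hd
    ![![0, a + 1, 0, 0], ![0, 0, b + 1, 0], ![0, 0, 0, d + 1]]
    ![![x₁ + 1, y₁, u₁, v₁], ![x₂ + 1, y₂, u₂, v₂], ![x₃ + 1, y₃, u₃, v₃]] ?_ ?_
  · intro r
    fin_cases r
    · simpa using r₁
    · simp; linarith
    · simp; linarith
  · intro J y hy α β hαβ
    have red := exists_reduced (n₂ := p j) (n₃ := p k) (n₄ := p l) hpi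
      (y₁ := y i) (y₂ := y j) (y₃ := y k) (y₄ := y l) (a := a) (b := b) (d := d)
      ⟨x₁, y₁, u₁, v₁, r₁, by simpa using hy 0⟩
      ⟨x₂, y₂, u₂, v₂, by linarith, by simpa using hy 1⟩
      ⟨x₃, y₃, u₃, v₃, by linarith, by simpa using hy 2⟩
    obtain ⟨t, q, r, s, hq, hr, hs, eα, fα⟩ := red _ (α i) (α j) (α k) (α l) rfl
    obtain ⟨t', q', r', s', hq', hr', hs', eβ, fβ⟩ := red _ (β i) (β j) (β k) (β l) rfl
    rw [← fα, ← fβ]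
    have E : (t : ℤ) * p i + q * p j + r * p k + s * p l
        = t' * p i + q' * p j + r' * p k + s' * p l := by
      exact_mod_cast (eα.trans hαβ).trans eβ.symm
    -- elements of the box divide `F + p i`, hence lie in the Apéry set of `p i`
    have box : ∀ {t q r s t' q' r' s' : ℕ}, q ≤ a → r ≤ b → s ≤ d →
        (t : ℤ) * p i + q * p j + r * p k + s * p l
          = t' * p i + q' * p j + r' * p k + s' * p l → t' ≤ t := by
      intro t q r s t' q' r' s' hq hr hs E
      by_contra hcon
      have := h.coeff_eq_zero (i := i) (j := j) (k := k) (l := l) (x := t' - t)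
        (y := a - q + q') (u := b - r + r') (v := d - s + s') (by omega) (by omega) (by omega)
        (by omega) (by linear_combination e0 + E)
      omega
    obtain rfl : t = t' := le_antisymm (box hq' hr' hs' E.symm) (box hq hr hs E)
    have := huniq (a - q + q') (b - r + r') (d - s + s') a b d (by omega) (by omega) (by omega)
      (by omega) (by omega) (by omega) (by linear_combination e0 + E) e0
    obtain ⟨rfl, rfl, rfl⟩ : q = q' ∧ r = r' ∧ s = s' := by omega
    rfl

theorem exists_notMem_of_not_ci {K : Type*} [Field K]
    (h : CriticalData (fun n => (p n : ℤ)) c S F) (hci : ¬ IsCompleteIntersection K p)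
    (i : Fin 4) : ∃ m, m ≠ i ∧ c m * p m - p i ∉ S := by
  by_contra hcon
  obtain ⟨j, hj⟩ := exists_ne i
  obtain ⟨k, l, hd⟩ := exists_distinct4 hj.symm
  refine hci (h.isCompleteIntersection_of_unique hd ?_)
  intro y u v y' u' v' hy hu hv hy' hu' hv' e e'
  by_contra hne
  exact hcon (h.exists_notMem_of_factorizations hd hy hu hv hy' hu' hv' e e' hne)

theorem crit_ne_of_not_ci {K : Type*} [Field K]
    (h : CriticalData (fun n => (p n : ℤ)) c S F) (hci : ¬ IsCompleteIntersection K p)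
    (hb : ∃ b : Fin 4 → ℤ, ∑ m, b m * p m = 1) (hij : i ≠ j) : c i * p i ≠ c j * p j := by
  intro heq
  obtain ⟨k, l, hd⟩ := exists_distinct4 hij
  have hmiss := h.exists_notMem_of_not_ci hci
  by_cases hkl : c k * p k = c l * p l
  · obtain ⟨d, e, P, Q, R, T, hd0, he0, hP, hQ, hR, hT, hPQ, hRT, hde, ei, ej, ek, el,
      ⟨u, v, hu, hv, eu⟩, ⟨u', v', hu', hv', ed⟩⟩ := h.exists_gluing hd hb heq hkl hmiss
    lift d to ℕ using hd0.le
    lift e to ℕ using he0.le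
    lift P to ℕ using hP.le
    lift Q to ℕ using hQ.le
    lift R to ℕ using hR.le
    lift T to ℕ using hT.le
    lift u to ℕ using hu
    lift v to ℕ using hv
    lift u' to ℕ using hu'
    lift v' to ℕ using hv'
    exact hci (isCompleteIntersection_of_gluing hd (Nat.isCoprime_iff_coprime.1 hPQ)
      (Nat.isCoprime_iff_coprime.1 hRT) (Nat.isCoprime_iff_coprime.1 hde) (by omega) (by omega)
      (by omega) (by exact_mod_cast eu) (by exact_mod_cast ed) (by exact_mod_cast ei)
      (by exact_mod_cast ej) (by exact_mod_cast ek) (by exact_mod_cast el))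
  · exact h.false_of_crit_eq hd heq hkl hmiss

/-- Each generator is missed by some critical element, and no critical element misses two
generators, so a choice `ρ i` of a critical element missing `p i` is a permutation without fixed
points: a four-cycle or a double transposition. -/
theorem bound_of_not_ci {K : Type*} [Field K]
    (h : CriticalData (fun n => (p n : ℤ)) c S F) (hci : ¬ IsCompleteIntersection K p)
    (hb : ∃ b : Fin 4 → ℤ, ∑ m, b m * p m = 1) :
    25 * ∏ m, (p m : ℤ) ≤ (F + ∑ m, (p m : ℤ)) ^ 3 := by
  choose ρ hρ hmiss using h.exists_notMem_of_not_ci hci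
  -- a critical element misses at most one generator
  have hone : ∀ i i' j, i ≠ i' → j ≠ i → j ≠ i' → c j * p j - p i ∉ S →
      c j * p j - p i' ∈ S := by
    intro i i' j hii hji hji' hn
    by_contra hn'
    obtain ⟨l, hd⟩ : ∃ l, Distinct4 l j i i' := by
      obtain ⟨k, l, hd⟩ := exists_distinct4 hji
      rcases hd.eq_or i' with rfl | rfl | rfl | rfl
      · exact absurd rfl hji'
      · exact absurd rfl hii
      · exact ⟨l, hd.rotate.rotate.rotate⟩
      · exact ⟨k, hd.swapLast.rotate.rotate.rotate⟩
    exact h.crit_ne_of_not_ci hci hb hd.1.symm (h.crit_eq_of_notMem hd hn hn')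
  have hinj : Function.Injective ρ := by
    intro i i' hii
    by_contra hne
    have h2 := hmiss i'
    rw [← hii] at h2
    exact h2 (hone i i' (ρ i) hne (hρ i) (hii ▸ hρ i') (hmiss i))
  have hsurj : Function.Surjective ρ := Finite.surjective_of_injective hinj
  have hmem : ∀ i j, j ≠ i → ρ i ≠ j → c j * p j - p i ∈ S := by
    intro i j hji hij
    obtain ⟨i', rfl⟩ := hsurj j
    exact hone i' i (ρ i') (fun e => hij (by rw [e])) (hρ i') hji (hmiss i')
  have cycle : ∀ i k l, Distinct4 i (ρ i) k l → ρ (ρ i) = k →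
      25 * ∏ m, (p m : ℤ) ≤ (F + ∑ m, (p m : ℤ)) ^ 3 := by
    intro i k l hd hk
    obtain ⟨j, hj⟩ : ∃ j, ρ i = j := ⟨_, rfl⟩
    rw [hj] at hd hk
    obtain ⟨hij, hik, hil, hjk, hjl, hkl⟩ := id hd
    have hρk : ρ k ≠ k ∧ ρ k ≠ j := ⟨hρ k, fun e => hik (hinj (hj.trans e.symm))⟩
    have hρl : ρ l ≠ l ∧ ρ l ≠ j ∧ ρ l ≠ k :=
      ⟨hρ l, fun e => hil (hinj (hj.trans e.symm)), fun e => hjl (hinj (hk.trans e.symm))⟩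
    have hl : ρ l = i := by
      rcases hd.eq_or (ρ l) with e | e | e | e
      · exact e
      · exact absurd e hρl.2.1
      · exact absurd e hρl.2.2
      · exact absurd e hρl.1
    have hk' : ρ k = l := by
      rcases hd.eq_or (ρ k) with e | e | e | e
      · exact absurd (hinj (hl.trans e.symm)).symm hkl
      · exact absurd e hρk.2
      · exact absurd e hρk.1
      · exact e
    have hd' : Distinct4 l k j i := ⟨hkl.symm, hjl.symm, hil.symm, hjk.symm, hik.symm, hij.symm⟩
    exact h.bound_of_cycle hd' hb (hmem l k hkl (hl ▸ hik)) (hmem l j hjl (hl ▸ hij))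
      (hmem k j hjk (hk' ▸ hjl.symm)) (hmem k i hik (hk' ▸ hil.symm))
      (hmem j i hij (hk ▸ hik.symm)) (hmem j l hjl.symm (hk ▸ hkl))
      (hmem i l hil.symm (hj ▸ hjl)) (hmem i k hik.symm (hj ▸ hjk))
  obtain ⟨k, l, hd⟩ := exists_distinct4 (hρ 0).symm
  rcases hd.eq_or (ρ (ρ 0)) with e | e | e | e
  · obtain ⟨j, hj⟩ : ∃ j, ρ 0 = j := ⟨_, rfl⟩
    rw [hj] at hd e
    obtain ⟨hij, hik, hil, hjk, hjl, hkl⟩ := id hd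
    exact (h.false_of_double_transposition hd (hj ▸ hmiss 0) (hmem 0 k hik.symm (hj ▸ hjk))
      (hmem 0 l hil.symm (hj ▸ hjl)) (hmem j k hjk.symm (e ▸ hik)) (hmem j l hjl.symm (e ▸ hil))
      (hmem k j hjk fun e' => hik (hinj (hj.trans e'.symm)))
      (hmem k 0 hik fun e' => hjk (hinj (e.trans e'.symm)))).elim
  · exact absurd e (hρ _)
  · exact cycle 0 k l hd e
  · exact cycle 0 l k hd.swapLast e

end CriticalData

/-! ### Frobenius numbers of scaled semigroups -/

theorem mem_intSet {S : AddSubmonoid ℕ} {n : ℕ} : (n : ℤ) ∈ intSet S ↔ n ∈ S := by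
  simp [intSet]

theorem nonneg_of_mem_intSet {S : AddSubmonoid ℕ} {z : ℤ} (hz : z ∈ intSet S) : 0 ≤ z := by
  obtain ⟨n, -, rfl⟩ := hz
  exact Int.natCast_nonneg n

theorem mem_intSet_semigroupOf {m : ℕ} {d : Fin m → ℕ} {z : ℤ} :
    z ∈ intSet (semigroupOf d) ↔ ∃ a : Fin m → ℤ, (∀ i, 0 ≤ a i) ∧ z = ∑ i, a i * d i := by
  constructor
  · rintro ⟨n, hn, rfl⟩
    obtain ⟨a, rfl⟩ := AddSubmonoid.exists_of_mem_closure_range _ _ hn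
    exact ⟨fun i => a i, fun i => Int.natCast_nonneg _, by simp⟩
  · rintro ⟨a, ha, rfl⟩
    lift a to Fin m → ℕ using ha
    have : ∑ i, (a i : ℤ) * d i = ((∑ i, a i * d i : ℕ) : ℤ) := by push_cast; rfl
    rw [this, mem_intSet]
    exact sum_mem fun i _ => by
      simpa using (semigroupOf d).nsmul_mem (AddSubmonoid.subset_closure ⟨i, rfl⟩) (a i)

theorem exists_criticalData {p : Fin 4 → ℕ} (hp : ∀ i, 0 < p i) {F : ℤ}
    (hF : ∀ z : ℤ, z ∈ intSet (semigroupOf p) ↔ F - z ∉ intSet (semigroupOf p)) :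
    ∃ (c : Fin 4 → ℤ) (S : AddSubmonoid ℤ), CriticalData (fun n => (p n : ℤ)) c S F := by
  have hc : ∀ i, ∃ t : ℤ, (0 < t ∧ ∃ a : Fin 4 → ℤ, (∀ j, 0 ≤ a j) ∧ a i = 0 ∧
      t * p i = ∑ j, a j * p j) ∧ ∀ t' : ℤ, (0 < t' ∧ ∃ a : Fin 4 → ℤ, (∀ j, 0 ≤ a j) ∧
      a i = 0 ∧ t' * p i = ∑ j, a j * p j) → t ≤ t' := by
    intro i
    refine Int.exists_least_of_bdd ⟨0, fun z hz => hz.1.le⟩ ?_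
    obtain ⟨j, hj⟩ := exists_ne i
    refine ⟨p j, by exact_mod_cast hp j, Pi.single j (p i : ℤ), fun m => ?_, ?_, ?_⟩
    · rcases eq_or_ne m j with rfl | hm
      · simp
      · simp [hm]
    · simp [hj.symm]
    · rw [Finset.sum_eq_single j (fun m _ hm => by simp [hm]) (by simp)]
      simp [mul_comm]
  choose c hc1 hc2 using hc
  refine ⟨c, (semigroupOf p).map (Nat.castAddMonoidHom ℤ), fun i => by exact_mod_cast hp i,
    fun z => mem_intSet_semigroupOf, hF, fun i => (hc1 i).1, fun i => (hc1 i).2,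
    fun i t ht a ha h0 e => hc2 i t ⟨ht, a, ha, h0, e⟩⟩

/-- Two consecutive integers beyond the Frobenius number give a Bézout relation. -/
theorem exists_sum_eq_one {m : ℕ} {d : Fin m → ℕ} {F : ℤ}
    (hF : ∀ z : ℤ, z ∈ intSet (semigroupOf d) ↔ F - z ∉ intSet (semigroupOf d)) :
    ∃ b : Fin m → ℤ, ∑ i, b i * d i = 1 := by
  have key : ∀ z, F < z → z ∈ intSet (semigroupOf d) := fun z hz => (hF z).2 fun hm => by
    have := nonneg_of_mem_intSet hm
    omega
  obtain ⟨a, -, ha⟩ := mem_intSet_semigroupOf.1 (key (F + 1) (by omega))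
  obtain ⟨b, -, hb⟩ := mem_intSet_semigroupOf.1 (key (F + 2) (by omega))
  refine ⟨fun i => b i - a i, ?_⟩
  simp only [sub_mul, Finset.sum_sub_distrib, ← ha, ← hb]
  ring

theorem exists_of_mem_scaleAppend {m : ℕ} {a e : ℕ} {d : Fin m → ℕ} {n : ℕ}
    (hn : n ∈ semigroupOf (scaleAppend a d e)) : ∃ s ∈ semigroupOf d, ∃ t, n = a * s + t * e := by
  obtain ⟨w, rfl⟩ := AddSubmonoid.exists_of_mem_closure_range _ _ hn
  refine ⟨∑ i : Fin m, w i.castSucc * d i, sum_mem fun i _ => ?_, w (Fin.last m), ?_⟩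
  · simpa using (semigroupOf d).nsmul_mem (AddSubmonoid.subset_closure ⟨i, rfl⟩) (w i.castSucc)
  · simp [Fin.sum_univ_castSucc, scaleAppend, Finset.mul_sum, mul_left_comm]

/-- Gaps of `S` give gaps of `⟨a S, e⟩`; this is the lower bound in
`F(⟨a S, e⟩) = a F(S) + (a - 1) e`. -/
theorem gap_of_scaleAppend {m : ℕ} {a e : ℕ} {d : Fin m → ℕ} (ha : 0 < a) (hae : Nat.gcd a e = 1)
    (he : e ∈ semigroupOf d) {z : ℤ} (hz : z ∉ intSet (semigroupOf d)) :
    a * z + (a - 1) * e ∉ intSet (semigroupOf (scaleAppend a d e)) := by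
  rintro ⟨n, hn, hnz⟩
  obtain ⟨s, hs, t, rfl⟩ := exists_of_mem_scaleAppend hn
  have hnz' : (a : ℤ) * s + t * e = a * z + (a - 1) * e := by simpa using hnz
  have hcop : IsCoprime (a : ℤ) e := Nat.isCoprime_iff_coprime.2 hae
  obtain ⟨r, hr⟩ : (a : ℤ) ∣ t + 1 :=
    hcop.dvd_of_dvd_mul_right ⟨z + e - s, by linear_combination hnz'⟩
  have hr0 : 0 < r := by
    by_contra hcon
    nlinarith
  lift r to ℕ using hr0.le
  have ha0 : (a : ℤ) ≠ 0 := by positivity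
  refine hz ⟨s + (r - 1) * e, (semigroupOf d).add_mem hs ?_, ?_⟩
  · simpa using (semigroupOf d).nsmul_mem he (r - 1)
  · refine mul_left_cancel₀ ha0 ?_
    have : ((r - 1 : ℕ) : ℤ) = r - 1 := by push_cast [show 1 ≤ r by omega]; ring
    push_cast
    rw [this]
    linear_combination hnz' - e * hr

theorem IsMinimalSystem.exists_frobeniusNumber {m : ℕ} (hm : 2 ≤ m) {d : Fin m → ℕ}
    (h : IsMinimalSystem d) : ∃ F, FrobeniusNumber F (Set.range d) := by
  refine exists_frobeniusNumber_iff.2 ⟨?_, ?_⟩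
  · refine Nat.dvd_one.1 ?_
    rw [← h.gcd_eq_one]
    exact Finset.dvd_gcd fun i _ => Nat.setGcd_dvd_of_mem ⟨i, rfl⟩
  · rintro ⟨i, hi⟩
    have : Nontrivial (Fin m) := Fin.nontrivial_iff_two_le.2 hm
    obtain ⟨j, hj⟩ := exists_ne i
    refine h.minimal j ?_
    have h1 : 1 ∈ AddSubmonoid.closure (d '' {l | l ≠ j}) :=
      AddSubmonoid.subset_closure ⟨i, hj.symm, hi⟩
    simpa using nsmul_mem h1 (d j)

/-- A symmetric semigroup with four generators that is not a complete intersection has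
`F + ∑ p ≥ (25 ∏ p) ^ (1 / 3)`. -/
theorem rpow_le_of_symmetric_not_ci {k : Type*} [Field k] {p : Fin 4 → ℕ}
    (h : IsSymmetricNotCI k p) : ∃ F : ℤ, F ∉ intSet (semigroupOf p) ∧
      (25 : ℝ) ^ (1 / 3 : ℝ) * (∏ j, (p j : ℝ)) ^ (1 / 3 : ℝ) ≤ F + ∑ j, (p j : ℝ) := by
  obtain ⟨F, hF, hsymm⟩ := h.symmetric
  refine ⟨F, hF.1, ?_⟩
  obtain ⟨c, S, hc⟩ := exists_criticalData h.minimalSystem.pos hsymm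
  have hbound := hc.bound_of_not_ci h.not_ci (exists_sum_eq_one hsymm)
  have hbound' : 25 * ∏ j, (p j : ℝ) ≤ (F + ∑ j, (p j : ℝ)) ^ 3 := by exact_mod_cast hbound
  have h0 : 0 ≤ ∏ j, (p j : ℝ) := by positivity
  have hg : 0 ≤ F + ∑ j, (p j : ℝ) := by
    by_contra hcon
    have := Odd.pow_neg (n := 3) (by decide) (not_le.1 hcon)
    linarith
  rw [← Real.mul_rpow (by norm_num) h0]
  calc (25 * ∏ j, (p j : ℝ)) ^ (1 / 3 : ℝ)
      ≤ ((F + ∑ j, (p j : ℝ)) ^ 3) ^ (1 / 3 : ℝ) :=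
        Real.rpow_le_rpow (by positivity) hbound' (by norm_num)
    _ = F + ∑ j, (p j : ℝ) := by
        rw [one_div]
        exact_mod_cast Real.pow_rpow_inv_natCast hg (n := 3) (by norm_num)

theorem lemma4 (k : Type*) [Field k] (p : Fin 4 → ℕ) (a₁ a₂ q₅ d₆ : ℕ)
    (ha₁ : 1 < a₁) (ha₂ : 1 < a₂)
    (hS₄ : IsSymmetricNotCI k p)
    (hW₅ : IsSymmetricNotCI k (scaleAppend a₂ p q₅))
    (hW₆ : IsSymmetricNotCI k (scaleAppend a₁ (scaleAppend a₂ p q₅) d₆))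
    (hq₅ : q₅ ∈ (semigroupOf p : Set ℕ) \ Set.range p)
    (hgcd₂ : Nat.gcd a₂ q₅ = 1)
    (hd₆ : d₆ ∈ (semigroupOf (scaleAppend a₂ p q₅) : Set ℕ) \ Set.range (scaleAppend a₂ p q₅))
    (hgcd₁ : Nat.gcd a₁ d₆ = 1) :
    ∃ F : ℕ, FrobeniusNumber F (Set.range (scaleAppend a₁ (scaleAppend a₂ p q₅) d₆)) ∧
      (a₁ : ℝ) * (a₂ * ((25 : ℝ) ^ (1 / 3 : ℝ) * (∏ j, (p j : ℝ)) ^ (1 / 3 : ℝ) + q₅) + d₆)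
        - (a₁ * a₂ * ∑ j, (p j : ℝ) + a₁ * q₅ + d₆) ≤ (F : ℝ) := by
  obtain ⟨f, hf, hbound⟩ := rpow_le_of_symmetric_not_ci hS₄
  obtain ⟨F, hF⟩ := hW₆.minimalSystem.exists_frobeniusNumber (by norm_num)
  refine ⟨F, hF, ?_⟩
  have hgap := gap_of_scaleAppend (by omega) hgcd₁ hd₆.1
    (gap_of_scaleAppend (by omega) hgcd₂ hq₅.1 hf)
  set z : ℤ := a₁ * (a₂ * f + (a₂ - 1) * q₅) + (a₁ - 1) * d₆ with hz
  have hle : z ≤ F := by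
    by_contra hcon
    lift z to ℕ using by omega with n hn
    exact hgap (mem_intSet.2 ((frobeniusNumber_iff.1 hF).2 n (by omega)))
  have hle' : (a₁ : ℝ) * (a₂ * f + (a₂ - 1) * q₅) + (a₁ - 1) * d₆ ≤ F := by
    exact_mod_cast hz ▸ hle
  have hmul := mul_le_mul_of_nonneg_left hbound (by positivity : (0 : ℝ) ≤ a₁ * a₂)
  linarith
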